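/- Let $A$ be a ring (associative, with $1$, not necessarily commutative), $X$ a finite partially ordered set, and $(e_x)_{x\in X}$ a family of elements of $A$ with $e_xe_y=\delta_{xy}e_x$ and $\sum_{x\in X}e_x=1$. A subset $Y\subset X$ is an initial segment if $x\le y$ and $y\in Y$ imply $x\in Y$. For an initial segment $Y$ put $A_Y:=A/\sum_{x\notin Y}Ae_xA$, where $Ae_xA$ is the two-sided ideal generated by $e_x$, and denote the image of $e_y$ in $A_Y$ again by $e_y$; modules are left modules. Assume: (i) for every $y\in X$, the $A$-module $A_Ye_y$ is, up to isomorphism, the same for all initial segments $Y$ having $y$ as a maximal element; call it $M_y$ (one may take $Y=\{x\mid x\le y\}$); (ii) for every $x\in X$, the $A$-module $Ae_x$ has a finite filtration whose associated graded module is isomorphic to a finite product of modules of the form $M_y$, $y\in X$ (repetitions allowed). Then for every initial segment $Y$ of $X$ the pair $(\mathrm{Mod}\,A,\mathrm{Mod}\,A_Y)$ satisfies condition (R): $\mathrm{RHom}_A$ and $\mathrm{RHom}_{A_Y}$ are defined on all unbounded complexes (every complex has a K-injective resolution in each of the two categories), and for all $V,W\in D(\mathrm{Mod}\,A_Y)$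 the canonical morphism $$\mathrm{RHom}_{A_Y}(V,W)\longrightarrow \mathrm{RHom}_A(V,W),$$ where on the right $V$ and $W$ are viewed as complexes of $A$-modules through $A\to A_Y$, is an isomorphism in the derived category $D\mathbb Z$ of abelian groups. -/

import Mathlib

open CategoryTheory

universe u v w v₁ v₂ u₁ u₂

/-! ### Derived Hom complexes and condition (R) -/

/-- A K-injective resolution of a (possibly unbounded) cochain complex `W`: a quasi-isomorphism
from `W` to a K-injective complex. -/
structure KInjectiveResolution {C : Type u₁} [Category.{v₁} C] [Abelian C]
    (W : CochainComplex C ℤ) where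
  /-- the K-injective complex -/
  complex : CochainComplex C ℤ
  /-- the resolution morphism -/
  ι : W ⟶ complex
  quasiIso : QuasiIso ι
  isKInjective : complex.IsKInjective

/-- The complex of abelian groups `RHom(V, W)`, computed as the total Hom complex
`Hom^•(V, I)` by means of a K-injective resolution `W ⟶ I`. -/
noncomputable def RHomComplex {C : Type u₁} [Category.{v₁} C] [Abelian C]
    (V : CochainComplex C ℤ) {W : CochainComplex C ℤ} (I : KInjectiveResolution W) :
    CochainComplex AddCommGrpCat.{v₁} ℤ :=
  CochainComplex.HomComplex V I.complex

/-- For an additive functor `F` and a morphism of complexes `g : F K ⟶ L`, the morphism of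
complexes of abelian groups `Hom^•(V, K) ⟶ Hom^•(F V, F K) ⟶ Hom^•(F V, L)`, `z ↦ g ∘ F z`. -/
noncomputable def homComplexMap {C : Type u₁} [Category.{v₁} C] [Abelian C]
    {D : Type u₂} [Category.{v₁} D] [Abelian D] (F : C ⥤ D) [F.Additive]
    (V : CochainComplex C ℤ) {K : CochainComplex C ℤ} {L : CochainComplex D ℤ}
    (g : (F.mapHomologicalComplex (ComplexShape.up ℤ)).obj K ⟶ L) :
    CochainComplex.HomComplex V K ⟶
      CochainComplex.HomComplex ((F.mapHomologicalComplex (ComplexShape.up ℤ)).obj V) L where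
  f n := AddCommGrpCat.ofHom
    { toFun := fun z : CochainComplex.HomComplex.Cochain V K n => (CochainComplex.HomComplex.Cochain.map z F).comp
        (CochainComplex.HomComplex.Cochain.ofHom g) (add_zero n)
      map_zero' := by
        simp
      map_add' := fun z z' => by
        simp }
  comm' n m _ := by
    ext z
    have key : ∀ z : CochainComplex.HomComplex.Cochain V K n,
        CochainComplex.HomComplex.δ n m ((CochainComplex.HomComplex.Cochain.map z F).comp
          (CochainComplex.HomComplex.Cochain.ofHom g) (add_zero n)) =
        (CochainComplex.HomComplex.Cochain.map (CochainComplex.HomComplex.δ n m z) F).comp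
          (CochainComplex.HomComplex.Cochain.ofHom g) (add_zero m) := fun z => by
      rw [CochainComplex.HomComplex.δ_comp_ofHom, CochainComplex.HomComplex.δ_map]
    exact key z

/-- `g : F I ⟶ J` is a comparison morphism between a resolution `W ⟶ I` and a resolution
`F W ⟶ J` if the triangle formed by `F W ⟶ F I ⟶ J` and `F W ⟶ J` commutes up to homotopy. -/
def IsComparison {C : Type u₁} [Category.{v₁} C] [Abelian C]
    {D : Type u₂} [Category.{v₁} D] [Abelian D] (F : C ⥤ D) [F.Additive]
    {W : CochainComplex C ℤ} (I : KInjectiveResolution W)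
    (J : KInjectiveResolution ((F.mapHomologicalComplex (ComplexShape.up ℤ)).obj W))
    (g : (F.mapHomologicalComplex (ComplexShape.up ℤ)).obj I.complex ⟶ J.complex) : Prop :=
  Nonempty (Homotopy ((F.mapHomologicalComplex (ComplexShape.up ℤ)).map I.ι ≫ g) J.ι)

/-- The canonical morphism `RHom(V, W) ⟶ RHom(F V, F W)` attached to a comparison morphism. -/
noncomputable def RHomComparison {C : Type u₁} [Category.{v₁} C] [Abelian C]
    {D : Type u₂} [Category.{v₁} D] [Abelian D] (F : C ⥤ D) [F.Additive]
    (V : CochainComplex C ℤ) {W : CochainComplex C ℤ} (I : KInjectiveResolution W)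
    (J : KInjectiveResolution ((F.mapHomologicalComplex (ComplexShape.up ℤ)).obj W))
    (g : (F.mapHomologicalComplex (ComplexShape.up ℤ)).obj I.complex ⟶ J.complex) :
    RHomComplex V I ⟶ RHomComplex ((F.mapHomologicalComplex (ComplexShape.up ℤ)).obj V) J :=
  homComplexMap F V g

/-- Condition (R) for an exact inclusion functor `F : 𝒢₂ ⥤ 𝒢₁`: the functors `RHom` are defined on
unbounded complexes of both categories (every complex has a K-injective resolution), and for all
complexes `V`, `W` in `𝒢₂` the canonical morphism `RHom_𝒢₂(V, W) ⟶ RHom_𝒢₁(F V, F W)` exists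
and is an isomorphism in the derived category of abelian groups (i.e. a quasi-isomorphism),
whatever the resolutions used to compute it. -/
def ConditionR {C : Type u₁} [Category.{v₁} C] [Abelian C]
    {D : Type u₂} [Category.{v₁} D] [Abelian D] (F : C ⥤ D) [F.Additive] : Prop :=
  (∀ W : CochainComplex C ℤ, Nonempty (KInjectiveResolution W)) ∧
  (∀ W : CochainComplex D ℤ, Nonempty (KInjectiveResolution W)) ∧
  ∀ (V W : CochainComplex C ℤ) (I : KInjectiveResolution W)
    (J : KInjectiveResolution ((F.mapHomologicalComplex (ComplexShape.up ℤ)).obj W)),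
    (∃ g, IsComparison F I J g) ∧
    ∀ g, IsComparison F I J g → QuasiIso (RHomComparison F V I J g)

/-! ### The quotient rings `A_Y` and the modules `A_Y e_y` -/

/-- The two-sided ideal `∑_{x ∉ Y} A e_x A`. -/
def outerIdeal {A : Type u} [Ring A] {X : Type v} (e : X → A) (Y : Set X) : Ideal A :=
  Ideal.span {r | ∃ x ∉ Y, ∃ a b : A, r = a * e x * b}

instance outerIdeal_isTwoSided {A : Type u} [Ring A] {X : Type v} (e : X → A) (Y : Set X) :
    (outerIdeal e Y).IsTwoSided where
  mul_mem_of_left {a} b ha := by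
    unfold outerIdeal at ha ⊢
    induction ha using Submodule.span_induction with
    | mem r hr =>
      obtain ⟨x, hx, c, d, rfl⟩ := hr
      exact Submodule.subset_span ⟨x, hx, c, d * b, by simp only [mul_assoc]⟩
    | zero => simp
    | add r s _ _ hr hs => rw [add_mul]; exact add_mem hr hs
    | smul c r _ hr => rw [smul_mul_assoc]; exact Submodule.smul_mem _ c hr

/-- The ring `A_Y = A / ∑_{x ∉ Y} A e_x A`. -/
abbrev QuotientRing {A : Type u} [Ring A] {X : Type v} (e : X → A) (Y : Set X) : Type u :=
  A ⧸ outerIdeal e Y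

/-- The left `A`-module `A_Y e_y`. -/
abbrev quotientModule {A : Type u} [Ring A] {X : Type v} (e : X → A) (Y : Set X) (y : X) :
    Submodule A (QuotientRing e Y) :=
  Submodule.span A {Ideal.Quotient.mk (outerIdeal e Y) (e y)}

/-- For every `y`, the module `A_Y e_y` is, up to isomorphism, the same for all initial segments
`Y` having `y` as a maximal element. -/
def StandardModulesIndependent {A : Type u} [Ring A] {X : Type v} [PartialOrder X]
    (e : X → A) : Prop :=
  ∀ (Y Y' : Set X) (y : X), IsLowerSet Y → IsLowerSet Y' →
    Maximal (· ∈ Y) y → Maximal (· ∈ Y') y →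
      Nonempty (quotientModule e Y y ≃ₗ[A] quotientModule e Y' y)

/-- The standard module `M_y`, i.e. `A_Y e_y` for the initial segment `Y = {x | x ≤ y}`. -/
abbrev standardModule {A : Type u} [Ring A] {X : Type v} [PartialOrder X] (e : X → A) (y : X) :
    Submodule A (QuotientRing e (Set.Iic y)) :=
  quotientModule e (Set.Iic y) y

/-- The class `⟨V_γ⟩`: the module `M` has a finite filtration whose associated graded module is
isomorphic to a finite product of members of the family `V` (repetitions allowed). -/
def HasFiltrationBy {A : Type u} [Ring A] {Γ : Type v} (V : Γ → Type w)
    [∀ γ, AddCommGroup (V γ)] [∀ γ, Module A (V γ)]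
    (M : Type w) [AddCommGroup M] [Module A M] : Prop :=
  ∃ (n : ℕ) (F : Fin (n + 1) → Submodule A M),
    Monotone F ∧ F 0 = ⊥ ∧ F (Fin.last n) = ⊤ ∧
    ∃ (k : ℕ) (γ : Fin k → Γ),
      Nonempty (((i : Fin n) → F i.succ ⧸ (F i.castSucc).submoduleOf (F i.succ)) ≃ₗ[A]
        ((j : Fin k) → V (γ j)))

/-- The inclusion of `Mod A_Y` into `Mod A`: restriction of scalars along `A ⟶ A_Y`. -/
noncomputable abbrev modInclusion {A : Type u} [Ring A] {X : Type v} (e : X → A) (Y : Set X) :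
    ModuleCat.{u} (QuotientRing e Y) ⥤ ModuleCat.{u} A :=
  ModuleCat.restrictScalars (Ideal.Quotient.mk (outerIdeal e Y))

/-! ### Quasi-isomorphisms in terms of elements -/

namespace AddCommGrpCat

variable (K : CochainComplex AddCommGrpCat.{u} ℤ) {i j k : ℤ}

/-! Write `I_Y` for `outerIdeal e Y`, `F` for restriction of scalars along `A → A_Y`, and `G =
Hom_A(A_Y, -)` for its right adjoint. Since `F` is exact, `G` preserves K-injectivity, and `Hom(F V,
J) = Hom(V, G J)` as complexes. If `I` resolves `W` and `J` resolves `F W`, the comparison morphism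
is therefore induced by a map `I ⟶ G J` between K-injective complexes. That map is a homotopy
equivalence as soon as the counit `F G J ⟶ J` is a quasi-isomorphism (`quasiIso_RHomComparison`).
When the terms of `J` are injective, the counit embeds the elements killed by `I_Y`, with cokernel
`Hom_A(I_Y, J)`. So everything reduces to the acyclicity of `Hom_A(I_Y, J)`
(`HomAcyclic.quasiIso_complexCounit`).

This is `homAcyclic_outerIdeal`, proved by descending from `X`, where the ideal is zero, to `Y`,
removing one maximal element at a time. Let `Z' = Z ∪ {x}` be one stage. As `x ∉ Y`, the idempotent
`e_x` kills the cohomology of `J`, so `Hom(A e_x, J)` is acyclic. The module `M_x ≅ A_{Z'} e_x` is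
`A e_x` modulo `I_{Z'} e_x`, a direct summand of `I_{Z'}`; hence `Hom(M_x, J)` is acyclic by
induction. Now `I_Z / I_{Z'}` is the trace of `e_x` in `A_{Z'}`. Since `M_x` is projective over
`A_{Z'}` and generated by its `e_x`-part, while `e_x M_z = 0` for `z ∈ Z`, the trace of `e_x` in
each filtered module `A_{Z'} e_y` is a direct summand of a finite power of `M_x`, and the quotient
`A_Z e_y` is filtered by the `M_z` with `z ∈ Z` (`IsFiltered.trace`). This carries both the
filtrations and the acyclicity from `Z'` to `Z`.

K-injective resolutions of unbounded complexes come from embedding a complex in an explicit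
K-injective one, injectively also in cohomology, iterating on the quotients, and totalizing with
products. -/

lemma exists_cycles_of_d_eq_zero (hjk : j + 1 = k) (x : K.X j) (hx : K.d j k x = 0) :
    ∃ c : K.cycles j, K.iCycles j c = x := by
  have hex : (ShortComplex.mk (K.iCycles j) (K.d j k) (K.iCycles_d j k)).Exact :=
    ShortComplex.exact_of_f_is_kernel _ (K.cyclesIsKernel j k (by simp [hjk]))
  exact (ShortComplex.ab_exact_iff _).1 hex x hx

lemma exists_toCycles_of_homologyπ_eq_zero (hij : i + 1 = j) (c : K.cycles j)
    (hc : K.homologyπ j c = 0) : ∃ y : K.X i, K.toCycles i j y = c := by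
  have hex : (ShortComplex.mk (K.toCycles i j) (K.homologyπ j) (K.toCycles_comp_homologyπ i j)).Exact :=
    ShortComplex.exact_of_g_is_cokernel _ (K.homologyIsCokernel i j (by simp; omega))
  exact (ShortComplex.ab_exact_iff _).1 hex c hc

variable {K} {L : CochainComplex AddCommGrpCat.{u} ℤ}

/-- The two clauses are injectivity and surjectivity in cohomology of degree `j`, phrased on
cochains so that later arguments can chase elements. -/
theorem quasiIso_iff_elements (f : K ⟶ L) :
    QuasiIso f ↔ ∀ i j k : ℤ, i + 1 = j → j + 1 = k →
      (∀ (x : K.X j) (y : L.X i), K.d j k x = 0 → f.f j x = L.d i j y → ∃ x', K.d i j x' = x) ∧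
      (∀ y : L.X j, L.d j k y = 0 → ∃ x y', K.d j k x = 0 ∧ f.f j x + L.d i j y' = y) := by
  have hπ (M : CochainComplex AddCommGrpCat.{u} ℤ) (j) : Function.Surjective (M.homologyπ j) :=
    (AddCommGrpCat.epi_iff_surjective _).1 inferInstance
  have hι (M : CochainComplex AddCommGrpCat.{u} ℤ) (j) : Function.Injective (M.iCycles j) :=
    (AddCommGrpCat.mono_iff_injective _).1 inferInstance
  have hnat (j) (c : K.cycles j) : HomologicalComplex.homologyMap f j (K.homologyπ j c) =
      L.homologyπ j (HomologicalComplex.cyclesMap f j c) := by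
    rw [← ConcreteCategory.comp_apply, HomologicalComplex.homologyπ_naturality,
      ConcreteCategory.comp_apply]
  have hcyc (j) (c : K.cycles j) : L.iCycles j (HomologicalComplex.cyclesMap f j c) =
      f.f j (K.iCycles j c) := by
    rw [← ConcreteCategory.comp_apply, HomologicalComplex.cyclesMap_i, ConcreteCategory.comp_apply]
  have hto (M : CochainComplex AddCommGrpCat.{u} ℤ) (i j) (y : M.X i) :
      M.iCycles j (M.toCycles i j y) = M.d i j y := by
    rw [← ConcreteCategory.comp_apply, HomologicalComplex.toCycles_i]
  have hdi (M : CochainComplex AddCommGrpCat.{u} ℤ) (j k) (c : M.cycles j) :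
      M.d j k (M.iCycles j c) = 0 := by
    rw [← ConcreteCategory.comp_apply, HomologicalComplex.iCycles_d]; rfl
  have hπto (M : CochainComplex AddCommGrpCat.{u} ℤ) (i j) (y : M.X i) :
      M.homologyπ j (M.toCycles i j y) = 0 := by
    rw [← ConcreteCategory.comp_apply, HomologicalComplex.toCycles_comp_homologyπ]; rfl
  constructor
  · intro hf i j k hij hjk
    have hiso : IsIso (HomologicalComplex.homologyMap f j) := inferInstance
    have hbij := ConcreteCategory.bijective_of_isIso (HomologicalComplex.homologyMap f j)
    constructor
    · intro x y hx hxy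
      obtain ⟨c, rfl⟩ := exists_cycles_of_d_eq_zero K hjk x hx
      have : K.homologyπ j c = 0 := by
        apply hbij.1
        rw [hnat, map_zero, ← hπto L i j y]
        congr 1
        apply hι
        rw [hcyc, hxy, hto]
      obtain ⟨x', rfl⟩ := exists_toCycles_of_homologyπ_eq_zero K hij c this
      exact ⟨x', (hto K i j x').symm⟩
    · intro y hy
      obtain ⟨c, rfl⟩ := exists_cycles_of_d_eq_zero L hjk y hy
      obtain ⟨h, hh⟩ := hbij.2 (L.homologyπ j c)
      obtain ⟨b, rfl⟩ := hπ K j h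
      rw [hnat] at hh
      obtain ⟨y', hy'⟩ := exists_toCycles_of_homologyπ_eq_zero L hij
        (c - HomologicalComplex.cyclesMap f j b) (by rw [map_sub, hh, sub_self])
      refine ⟨K.iCycles j b, y', hdi K j k b, ?_⟩
      rw [← hto, hy', map_sub, hcyc]
      abel
  · intro H
    rw [quasiIso_iff]
    intro j
    rw [quasiIsoAt_iff_isIso_homologyMap]
    obtain ⟨hinj, hsurj⟩ := H (j - 1) j (j + 1) (by omega) rfl
    rw [ConcreteCategory.isIso_iff_bijective]
    constructor
    · rw [injective_iff_map_eq_zero]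
      intro h hh
      obtain ⟨c, rfl⟩ := hπ K j h
      rw [hnat] at hh
      obtain ⟨y, hy⟩ := exists_toCycles_of_homologyπ_eq_zero L (i := j - 1) (by omega) _ hh
      obtain ⟨x', hx'⟩ := hinj (K.iCycles j c) y (hdi K _ _ c) (by rw [← hcyc, ← hy, hto])
      rw [← hπto K (j - 1) j x']
      congr 1
      apply hι
      rw [hto, hx']
    · intro h
      obtain ⟨c, rfl⟩ := hπ L j h
      obtain ⟨x, y', hx, hxy⟩ := hsurj (L.iCycles j c) (hdi L _ _ c)
      obtain ⟨b, rfl⟩ := exists_cycles_of_d_eq_zero K rfl x hx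
      refine ⟨K.homologyπ j b, ?_⟩
      rw [hnat, ← add_zero (L.homologyπ j _), ← hπto L (j - 1) j y', ← map_add]
      congr 1
      apply hι
      rw [map_add, hcyc, hto, hxy]

end AddCommGrpCat

namespace ModuleCat

variable {R : Type u} [Ring R] {K L : CochainComplex (ModuleCat.{w} R) ℤ}

theorem quasiIso_iff_elements (f : K ⟶ L) :
    QuasiIso f ↔ ∀ i j k : ℤ, i + 1 = j → j + 1 = k →
      (∀ (x : K.X j) (y : L.X i), K.d j k x = 0 → f.f j x = L.d i j y → ∃ x', K.d i j x' = x) ∧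
      (∀ y : L.X j, L.d j k y = 0 → ∃ x y', K.d j k x = 0 ∧ f.f j x + L.d i j y' = y) := by
  have := HomologicalComplex.quasiIso_map_iff_of_preservesHomology f (forget₂ (ModuleCat.{w} R) Ab)
  rw [← this]
  exact AddCommGrpCat.quasiIso_iff_elements _

end ModuleCat

/-! ### Embedding a complex of modules into a K-injective one -/

namespace ModuleCat

variable {R : Type u} [Ring R]

lemma injective_prod (M N : ModuleCat.{w} R) [Injective M] [Injective N] :
    Injective (ModuleCat.of R (M × N)) where
  factors {X Y} g f hf := by
    refine ⟨ModuleCat.ofHom ((Injective.factorThru (g ≫ ofHom (LinearMap.fst R M N)) f).hom.prod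
      (Injective.factorThru (g ≫ ofHom (LinearMap.snd R M N)) f).hom), ?_⟩
    ext x
    · exact ConcreteCategory.congr_hom
        (Injective.comp_factorThru (g ≫ ofHom (LinearMap.fst R M N)) f) x
    · exact ConcreteCategory.congr_hom
        (Injective.comp_factorThru (g ≫ ofHom (LinearMap.snd R M N)) f) x

lemma injective_pi {ι : Type} (M : ι → ModuleCat.{w} R) [∀ i, Injective (M i)] :
    Injective (ModuleCat.of R (∀ i, M i)) where
  factors {X Y} g f hf := by
    refine ⟨ModuleCat.ofHom (LinearMap.pi fun i =>
      (Injective.factorThru (g ≫ ofHom (LinearMap.proj i)) f).hom), ?_⟩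
    ext x i
    exact ConcreteCategory.congr_hom
        (Injective.comp_factorThru (g ≫ ofHom (LinearMap.proj (φ := fun i => M i) i)) f) x

/-- The product of the complexes `Q n` placed in degree `n` and of the contractible complexes
`E n = E n` placed in degrees `n - 1` and `n`. -/
noncomputable def elementaryComplex (Q E : ℤ → ModuleCat.{w} R) :
    CochainComplex (ModuleCat.{w} R) ℤ :=
  CochainComplex.of (fun n => ModuleCat.of R (Q n × E n × E (n + 1)))
    (fun n => ofHom ((0 : _ →ₗ[R] Q (n + 1)).prod
      ((LinearMap.snd R (E n) (E (n + 1)) ∘ₗ LinearMap.snd R (Q n) _).prod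
        (0 : _ →ₗ[R] E (n + 1 + 1)))))
    (fun n => by ext x <;> rfl)

lemma elementaryComplex_d_apply (Q E : ℤ → ModuleCat.{w} R) (n : ℤ)
    (x : (elementaryComplex Q E).X n) :
    (elementaryComplex Q E).d n (n + 1) x =
      (show Q (n + 1) × E (n + 1) × E (n + 1 + 1) from
        ((0, (show Q n × E n × E (n + 1) from x).2.2, 0))) := by
  exact ConcreteCategory.congr_hom (CochainComplex.of_d _ _ n) x

/-- A morphism from a term of an acyclic complex to an injective module which vanishes on
boundaries factors through the differential. -/
lemma exists_extend_of_acyclic {D : CochainComplex (ModuleCat.{w} R) ℤ} (hD : D.Acyclic)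
    (M : ModuleCat.{w} R) [Injective M] (i j k : ℤ) (hij : i + 1 = j) (hjk : j + 1 = k)
    (a : D.X j ⟶ M) (ha : D.d i j ≫ a = 0) : ∃ b : D.X k ⟶ M, D.d j k ≫ b = a := by
  have := hD j
  rw [D.exactAt_iff' i j k (by simp; omega) (by simp [hjk])] at this
  exact ⟨this.descToInjective a ha, this.comp_descToInjective a ha⟩

instance elementaryComplex_isKInjective (Q E : ℤ → ModuleCat.{w} R) [∀ n, Injective (Q n)] :
    (elementaryComplex Q E).IsKInjective where
  nonempty_homotopy_zero {D} f hD := by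
    let a (n : ℤ) : D.X n →ₗ[R] Q n := LinearMap.fst R (Q n) (E n × E (n + 1)) ∘ₗ (f.f n).hom
    let b (n : ℤ) : D.X n →ₗ[R] E n :=
      LinearMap.fst R (E n) (E (n + 1)) ∘ₗ LinearMap.snd R (Q n) (E n × E (n + 1)) ∘ₗ (f.f n).hom
    let c (n : ℤ) : D.X n →ₗ[R] E (n + 1) :=
      LinearMap.snd R (E n) (E (n + 1)) ∘ₗ LinearMap.snd R (Q n) (E n × E (n + 1)) ∘ₗ (f.f n).hom
    have hcomm (n : ℤ) (x : D.X n) : f.f (n + 1) (D.d n (n + 1) x) =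
        (show Q (n + 1) × E (n + 1) × E (n + 1 + 1) from (0, c n x, 0)) := by
      have := ConcreteCategory.congr_hom (f.comm n (n + 1)) x
      exact this.symm.trans (elementaryComplex_d_apply Q E n _)
    have hex (n : ℤ) : ∃ t : D.X (n + 1) ⟶ Q n, D.d n (n + 1) ≫ t = ofHom (a n) := by
      refine exists_extend_of_acyclic hD (Q n) (n - 1) n (n + 1) (by omega) rfl _ ?_
      obtain ⟨m, rfl⟩ : ∃ m, n = m + 1 := ⟨n - 1, by omega⟩
      rw [add_sub_cancel_right]
      ext x
      exact congrArg Prod.fst (hcomm m x)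
    choose t ht using hex
    -- Compatibility with the differentials says `a ∘ d = 0`, `b ∘ d = c` and `c ∘ d = 0`. So `a`
    -- has to be extended along `d`, which uses that `Q n` is injective, whereas `b` already
    -- contracts the `E` part, for arbitrary `E n`.
    let h (n : ℤ) : D.X (n + 1) ⟶ (elementaryComplex Q E).X n :=
      ofHom ((t n).hom.prod ((0 : _ →ₗ[R] E n).prod (b (n + 1))))
    let z : CochainComplex.HomComplex.Cochain D (elementaryComplex Q E) (-1) :=
      CochainComplex.HomComplex.Cochain.mk (fun p q hpq => eqToHom (by
        obtain rfl : p = q + 1 := by omega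
        rfl) ≫ h q)
    have hz (n : ℤ) : z.v (n + 1) n (by omega) = h n := by
      simp [z]
    refine ⟨(CochainComplex.HomComplex.Cochain.equivHomotopy f 0).symm ⟨z, ?_⟩⟩
    rw [CochainComplex.HomComplex.Cochain.ofHom_zero, add_zero]
    ext n : 1
    obtain ⟨m, rfl⟩ : ∃ m, n = m + 1 := ⟨n - 1, by omega⟩
    rw [CochainComplex.HomComplex.δ_v (-1) 0 (by omega) z (m + 1) (m + 1) (by omega) m (m + 1 + 1)
      (by omega) rfl, hz, hz]
    simp only [CochainComplex.HomComplex.Cochain.ofHom_v, Int.negOnePow_zero, one_smul]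
    refine ModuleCat.hom_ext (LinearMap.ext fun x => ?_)
    have e1 : (elementaryComplex Q E).d m (m + 1) (h m x) =
        (show Q (m + 1) × E (m + 1) × E (m + 1 + 1) from (0, b (m + 1) x, 0)) :=
      elementaryComplex_d_apply Q E m _
    have e2 : h (m + 1) (D.d (m + 1) (m + 1 + 1) x) =
        (show Q (m + 1) × E (m + 1) × E (m + 1 + 1) from (a (m + 1) x, 0, c (m + 1) x)) := by
      refine Prod.ext (ConcreteCategory.congr_hom (ht (m + 1)) x) (Prod.ext rfl ?_)
      exact congrArg (fun y => y.2.1) (hcomm (m + 1) x)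
    have e3 : f.f (m + 1) x =
        (show Q (m + 1) × E (m + 1) × E (m + 1 + 1) from (a (m + 1) x, b (m + 1) x, c (m + 1) x)) :=
      rfl
    have e4 : (0, b (m + 1) x, 0) + (a (m + 1) x, 0, c (m + 1) x) =
      (show Q (m + 1) × E (m + 1) × E (m + 1 + 1) from
        (a (m + 1) x, b (m + 1) x, c (m + 1) x)) := by simp
    exact e3.trans (e4.symm.trans (congrArg₂ (· + ·) e1 e2).symm)

instance injective_elementaryComplex_X (Q E : ℤ → ModuleCat.{w} R) [∀ n, Injective (Q n)]
    [∀ n, Injective (E n)] (n : ℤ) : Injective ((elementaryComplex Q E).X n) := by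
  have := injective_prod (E n) (E (n + 1))
  exact injective_prod (Q n) (ModuleCat.of R (E n × E (n + 1)))

/-- Every complex of modules embeds into a K-injective complex of injective modules, by a
morphism which is also injective in cohomology. -/
theorem exists_kInjective_embedding [Small.{w} R] (W : CochainComplex (ModuleCat.{w} R) ℤ) :
    ∃ (C : CochainComplex (ModuleCat.{w} R) ℤ) (ι : W ⟶ C), C.IsKInjective ∧
      (∀ n, Injective (C.X n)) ∧ (∀ n, Function.Injective (ι.f n)) ∧
      ∀ (i j : ℤ) (x : W.X j) (y : C.X i), i + 1 = j → ι.f j x = C.d i j y →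
        ∃ x', W.d i j x' = x := by
  -- The kernel of `W.X n → P n` consists of the boundaries, so the `Q` component gives injectivity
  -- in cohomology; the `E` component gives injectivity in each degree.
  let P (n : ℤ) : ModuleCat.{w} R := ModuleCat.of R (W.X n ⧸ LinearMap.range (W.d (n - 1) n).hom)
  let Q (n : ℤ) : ModuleCat.{w} R := Injective.under (P n)
  let E (n : ℤ) : ModuleCat.{w} R := Injective.under (W.X n)
  let q (n : ℤ) : W.X n →ₗ[R] Q n := (Injective.ι (P n)).hom ∘ₗ Submodule.mkQ _
  let e (n : ℤ) : W.X n →ₗ[R] E n := (Injective.ι (W.X n)).hom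
  have he (n : ℤ) : Function.Injective (e n) := (ModuleCat.mono_iff_injective _).1 inferInstance
  have hq (i j : ℤ) (hij : i + 1 = j) (x : W.X j) : q j x = 0 ↔ ∃ x', W.d i j x' = x := by
    obtain rfl : i = j - 1 := by omega
    have : Function.Injective (Injective.ι (P j)) := (ModuleCat.mono_iff_injective _).1 inferInstance
    have h1 : q j x = 0 ↔ Submodule.mkQ (LinearMap.range (W.d (j - 1) j).hom) x = 0 :=
      map_eq_zero_iff (Injective.ι (P j)).hom this
    rw [h1, Submodule.mkQ_apply, Submodule.Quotient.mk_eq_zero]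
    rfl
  let ι : W ⟶ elementaryComplex Q E :=
    { f n := ofHom ((q n).prod ((e n).prod (e (n + 1) ∘ₗ (W.d n (n + 1)).hom)))
      comm' i j hij := by
        obtain rfl : i + 1 = j := hij
        ext x
        refine (elementaryComplex_d_apply Q E i _).trans ?_
        refine Prod.ext ((hq i _ rfl _).2 ⟨x, rfl⟩).symm (Prod.ext rfl ?_)
        refine ((congrArg (e (i + 1 + 1)) ?_).trans (map_zero _)).symm
        exact ConcreteCategory.congr_hom (W.d_comp_d i (i + 1) (i + 1 + 1)) x }
  refine ⟨elementaryComplex Q E, ι, inferInstance, inferInstance, ?_, ?_⟩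
  · intro n x y hxy
    exact he n (congrArg (fun (t : Q n × E n × E (n + 1)) => t.2.1) hxy)
  · rintro i j x y rfl hxy
    rw [← hq i _ rfl]
    rw [elementaryComplex_d_apply] at hxy
    exact congrArg (fun (t : Q (i + 1) × E (i + 1) × E (i + 1 + 1)) => t.1) hxy

end ModuleCat

/-! ### Product total complexes -/

namespace ModuleCat

open CochainComplex.HomComplex

variable {R : Type u} [Ring R]

lemma apply_d_eq_neg_of_δ_eq_zero {C D : CochainComplex (ModuleCat.{w} R) ℤ} {φ : Cochain C D 1}
    (hφ : δ 1 2 φ = 0) (i j k : ℤ) (hij : i + 1 = j) (hjk : j + 1 = k) (x : C.X i) :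
    φ.v j k hjk (C.d i j x) = - D.d j k (φ.v i j hij x) := by
  have := Cochain.congr_v hφ i k (by omega)
  rw [δ_v 1 2 (by norm_num) φ i k (by omega) j j (by omega) hij] at this
  simp only [Int.negOnePow_even 2 (by decide), one_smul, Cochain.zero_v] at this
  exact eq_neg_of_add_eq_zero_right (ConcreteCategory.congr_hom this x)

/-- A sequence of complexes `C 0 ⟶ C 1 ⟶ ⋯` whose structure maps are cocycles of degree `1`
with zero composition. -/
structure TwistedSequence (R : Type u) [Ring R] where
  /-- the complexes of the sequence -/
  C : ℕ → CochainComplex (ModuleCat.{w} R) ℤ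
  /-- the structure maps -/
  φ : ∀ p, Cochain (C p) (C (p + 1)) 1
  δ_φ : ∀ p, δ 1 2 (φ p) = 0
  φ_φ : ∀ p, (φ p).comp (φ (p + 1)) (show (1 : ℤ) + 1 = 2 by norm_num) = 0

namespace TwistedSequence

variable (S : TwistedSequence.{u, w} R)

/-- The components of the differential of the total complex. -/
noncomputable def totalD (n : ℤ) : ∀ p : ℕ, (∀ p, (S.C p).X n) →ₗ[R] (S.C p).X (n + 1)
  | 0 => ((S.C 0).d n (n + 1)).hom ∘ₗ LinearMap.proj 0
  | p + 1 => ((S.C (p + 1)).d n (n + 1)).hom ∘ₗ LinearMap.proj (p + 1) +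
      ((S.φ p).v n (n + 1) rfl).hom ∘ₗ LinearMap.proj p

/-- The total complex, formed with products. -/
noncomputable def total : CochainComplex (ModuleCat.{w} R) ℤ :=
  CochainComplex.of (fun n => ModuleCat.of R (∀ p, (S.C p).X n))
    (fun n => ofHom (LinearMap.pi (S.totalD n)))
    (fun n => by
      have hd (p : ℕ) (y : (S.C p).X n) :
          (S.C p).d (n + 1) (n + 1 + 1) ((S.C p).d n (n + 1) y) = 0 :=
        ConcreteCategory.congr_hom ((S.C p).d_comp_d _ _ _) y
      refine ModuleCat.hom_ext (LinearMap.ext fun x => funext fun p => ?_)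
      match p with
      | 0 => exact hd 0 (x 0)
      | 1 =>
        change (S.C (0 + 1)).d (n + 1) (n + 1 + 1) ((S.C (0 + 1)).d n (n + 1) (x (0 + 1)) +
          (S.φ 0).v n (n + 1) rfl (x 0)) +
          (S.φ 0).v (n + 1) (n + 1 + 1) rfl ((S.C 0).d n (n + 1) (x 0)) = 0
        rw [map_add, hd, apply_d_eq_neg_of_δ_eq_zero (S.δ_φ 0) _ _ _ rfl rfl]
        exact add_neg_cancel_right 0 _
      | p + 2 =>
        have hφ : (S.φ (p + 1)).v (n + 1) (n + 1 + 1) rfl ((S.φ p).v n (n + 1) rfl (x p)) = 0 := by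
          have := Cochain.congr_v (S.φ_φ p) n (n + 1 + 1) (by omega)
          rw [Cochain.comp_v _ _ _ n (n + 1) (n + 1 + 1) rfl rfl] at this
          exact ConcreteCategory.congr_hom this (x p)
        change (S.C (p + 2)).d (n + 1) (n + 1 + 1) ((S.C (p + 2)).d n (n + 1) (x (p + 2)) +
          (S.φ (p + 1)).v n (n + 1) rfl (x (p + 1))) +
          (S.φ (p + 1)).v (n + 1) (n + 1 + 1) rfl ((S.C (p + 1)).d n (n + 1) (x (p + 1)) +
            (S.φ p).v n (n + 1) rfl (x p)) = 0
        rw [map_add, hd, map_add, hφ, apply_d_eq_neg_of_δ_eq_zero (S.δ_φ (p + 1)) _ _ _ rfl rfl,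
          zero_add, add_zero, add_neg_cancel])

/-- The projections from the total complex. -/
noncomputable def proj (p : ℕ) (n : ℤ) : S.total.X n ⟶ (S.C p).X n :=
  ofHom (LinearMap.proj (φ := fun p => (S.C p).X n) p)

variable {S} in
lemma total_ext {n : ℤ} {x y : S.total.X n} (h : ∀ p, S.proj p n x = S.proj p n y) : x = y :=
  funext h

/-- Constructor for elements of the total complex. -/
def totalMk {n : ℤ} (x : ∀ p, (S.C p).X n) : S.total.X n := x

/-- The morphism to the total complex with given components. -/
noncomputable def totalLift {n : ℤ} {M : ModuleCat.{w} R} (f : ∀ p, M ⟶ (S.C p).X n) :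
    M ⟶ S.total.X n :=
  ofHom (LinearMap.pi fun p => (f p).hom)

@[simp]
lemma totalLift_proj {n : ℤ} {M : ModuleCat.{w} R} (f : ∀ p, M ⟶ (S.C p).X n) (p : ℕ) :
    S.totalLift f ≫ S.proj p n = f p := rfl

lemma total_hom_ext {n : ℤ} {M : ModuleCat.{w} R} {f g : M ⟶ S.total.X n}
    (h : ∀ p, f ≫ S.proj p n = g ≫ S.proj p n) : f = g :=
  ModuleCat.hom_ext (LinearMap.ext fun x => total_ext fun p => ConcreteCategory.congr_hom (h p) x)

lemma total_d (n : ℤ) : S.total.d n (n + 1) = ofHom (LinearMap.pi (S.totalD n)) :=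
  CochainComplex.of_d (fun n => ModuleCat.of R (∀ p, (S.C p).X n))
    (fun n => ofHom (LinearMap.pi (S.totalD n))) n

lemma d_proj_zero (n m : ℤ) (h : n + 1 = m) :
    S.total.d n m ≫ S.proj 0 m = S.proj 0 n ≫ (S.C 0).d n m := by
  subst h
  rw [total_d]
  rfl

lemma d_proj_succ (p : ℕ) (n m : ℤ) (h : n + 1 = m) :
    S.total.d n m ≫ S.proj (p + 1) m =
      S.proj (p + 1) n ≫ (S.C (p + 1)).d n m + S.proj p n ≫ (S.φ p).v n m h := by
  subst h
  rw [total_d]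
  rfl

/-- The projections as cochains of degree `0`. -/
noncomputable def projCochain (p : ℕ) : Cochain S.total (S.C p) 0 :=
  Cochain.ofHoms (S.proj p)

lemma δ_projCochain_zero : δ 0 1 (S.projCochain 0) = 0 := by
  ext n m h
  simp [projCochain, d_proj_zero _ n m h]

lemma δ_projCochain_succ (p : ℕ) :
    δ 0 1 (S.projCochain (p + 1)) = -(S.projCochain p).comp (S.φ p) (zero_add 1) := by
  ext n m h
  simp [projCochain, d_proj_succ _ p n m h]

lemma cochain_ext {D : CochainComplex (ModuleCat.{w} R) ℤ} {n : ℤ} {z z' : Cochain D S.total n}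
    (h : ∀ p, z.comp (S.projCochain p) (add_zero n) = z'.comp (S.projCochain p) (add_zero n)) :
    z = z' := by
  ext i j hij : 1
  refine S.total_hom_ext fun p => ?_
  have := Cochain.congr_v (h p) i j hij
  simpa [projCochain] using this

lemma injective_total_X [∀ p n, Injective ((S.C p).X n)] (n : ℤ) : Injective (S.total.X n) :=
  injective_pi (fun p => (S.C p).X n)

/-- A null-homotopy is built one component at a time: the component `p + 1` must bound `F (p + 1)`
minus the contribution of component `p` through `φ p`, and K-injectivity of `C (p + 1)` solves this
once the difference is a cocycle. Products allow infinitely many components. -/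
theorem isKInjective_total [∀ p, (S.C p).IsKInjective] : S.total.IsKInjective where
  nonempty_homotopy_zero {D} f hD := by
    let F (p : ℕ) : Cochain D (S.C p) 0 := (Cochain.ofHom f).comp (S.projCochain p) (zero_add 0)
    have hF0 : δ 0 1 (F 0) = 0 := by
      simp [F, δ_projCochain_zero]
    have hF (p : ℕ) : δ 0 1 (F (p + 1)) = -(F p).comp (S.φ p) (zero_add 1) := by
      simp only [F, δ_ofHom_comp, δ_projCochain_succ, Cochain.comp_neg]
      rw [Cochain.comp_assoc_of_first_is_zero_cochain]
    have hex0 : ∃ h : Cochain D (S.C 0) (-1), δ (-1) 0 h = F 0 :=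
      CochainComplex.IsKInjective.eq_δ_of_cocycle (Cocycle.mk (F 0) 1 (by norm_num) hF0) hD (-1)
        (by norm_num)
    -- This invariant is what makes the next right-hand side a cocycle; it propagates because
    -- consecutive `φ` compose to zero.
    let P : ∀ p, Cochain D (S.C p) (-1) → Prop := fun p h =>
      (δ (-1) 0 h).comp (S.φ p) (zero_add 1) = (F p).comp (S.φ p) (zero_add 1)
    have hstep (p : ℕ) (h : Cochain D (S.C p) (-1)) (hh : P p h) :
        ∃ h' : Cochain D (S.C (p + 1)) (-1),
          δ (-1) 0 h' = F (p + 1) - h.comp (S.φ p) (by norm_num) := by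
      refine CochainComplex.IsKInjective.eq_δ_of_cocycle
        (Cocycle.mk (F (p + 1) - h.comp (S.φ p) (by norm_num)) 1 (by norm_num) ?_) hD (-1)
        (by norm_num)
      rw [δ_sub, hF, δ_comp h (S.φ p) _ 0 2 1 (by norm_num) (by norm_num) (by norm_num), S.δ_φ,
        Cochain.comp_zero, zero_add, hh]
      simp
    have hP (p : ℕ) (h : Cochain D (S.C p) (-1)) (h' : Cochain D (S.C (p + 1)) (-1))
        (hh' : δ (-1) 0 h' = F (p + 1) - h.comp (S.φ p) (by norm_num)) : P (p + 1) h' := by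
      simp only [P]
      rw [hh', Cochain.sub_comp, Cochain.comp_assoc h (S.φ p) (S.φ (p + 1)) (by norm_num)
        (show (1 : ℤ) + 1 = 2 by norm_num) (by norm_num), S.φ_φ, Cochain.comp_zero, sub_zero]
    let H : ∀ p, {h : Cochain D (S.C p) (-1) // P p h} := fun p =>
      Nat.rec ⟨hex0.choose, by simp only [P]; rw [hex0.choose_spec]⟩
        (fun p h => ⟨(hstep p h.1 h.2).choose, hP p h.1 _ (hstep p h.1 h.2).choose_spec⟩) p
    have hH0 : δ (-1) 0 (H 0).1 = F 0 := hex0.choose_spec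
    have hHs (p : ℕ) : δ (-1) 0 (H (p + 1)).1 = F (p + 1) - (H p).1.comp (S.φ p) (by norm_num) :=
      (hstep p (H p).1 (H p).2).choose_spec
    let h : Cochain D S.total (-1) := Cochain.mk fun i j hij => S.totalLift fun p => (H p).1.v i j hij
    have hproj (p : ℕ) : h.comp (S.projCochain p) (add_zero (-1)) = (H p).1 := by
      ext i j hij : 1
      simp [h, projCochain]
    refine ⟨(Cochain.equivHomotopy f 0).symm ⟨h, ?_⟩⟩
    rw [Cochain.ofHom_zero, add_zero]
    refine S.cochain_ext fun p => ?_
    match p with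
    | 0 =>
      have := δ_comp_zero_cochain h (S.projCochain 0) 0 (by norm_num)
      rw [hproj, hH0, δ_projCochain_zero, Cochain.comp_zero, zero_add] at this
      exact this
    | p + 1 =>
      have := δ_comp_zero_cochain h (S.projCochain (p + 1)) 0 (by norm_num)
      rw [hproj, hHs, δ_projCochain_succ, Cochain.comp_neg,
        ← Cochain.comp_assoc_of_second_is_zero_cochain, hproj] at this
      have key : F (p + 1) = (δ (-1) 0 h).comp (S.projCochain (p + 1)) (add_zero 0) := by
        generalize F (p + 1) = a at this ⊢
        rw [sub_eq_neg_add] at this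
        exact add_left_cancel this
      exact key

end TwistedSequence

end ModuleCat

/-! ### Unbounded K-injective resolutions of complexes of modules -/

namespace ModuleCat

open CochainComplex.HomComplex

variable {R : Type u} [Ring R]

/-- A termwise injective K-injective complex containing `W`, together with its shifted
quotient. -/
structure ResolutionStep (W : CochainComplex (ModuleCat.{w} R) ℤ) where
  /-- the K-injective complex -/
  C : CochainComplex (ModuleCat.{w} R) ℤ
  /-- the embedding -/
  ι : W ⟶ C
  /-- the shifted quotient -/
  next : CochainComplex (ModuleCat.{w} R) ℤ
  /-- the projection to the shifted quotient -/
  ψ : Cochain C next 1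
  isKInjective : C.IsKInjective
  injective_X : ∀ n, Injective (C.X n)
  ι_injective : ∀ n, Function.Injective (ι.f n)
  exists_d_eq : ∀ (i j : ℤ) (x : W.X j) (y : C.X i), i + 1 = j → ι.f j x = C.d i j y →
    ∃ x', W.d i j x' = x
  δ_ψ : δ 1 2 ψ = 0
  ψ_surjective : ∀ (p q : ℤ) (h : p + 1 = q), Function.Surjective (ψ.v p q h)
  ψ_eq_zero_iff : ∀ (p q : ℤ) (h : p + 1 = q) (x : C.X p), ψ.v p q h x = 0 ↔ ∃ w, ι.f p w = x

/-- The termwise quotient of a complex of modules by the image of a morphism. -/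
noncomputable def quotientComplex {W C : CochainComplex (ModuleCat.{w} R) ℤ} (ι : W ⟶ C) :
    CochainComplex (ModuleCat.{w} R) ℤ where
  X n := ModuleCat.of R (C.X n ⧸ LinearMap.range (ι.f n).hom)
  d i j := ofHom (Submodule.mapQ _ _ (C.d i j).hom (by
    rintro _ ⟨w, rfl⟩
    exact ⟨W.d i j w, (ConcreteCategory.congr_hom (ι.comm i j) w).symm⟩))
  shape i j hij := by
    refine ModuleCat.hom_ext (Submodule.linearMap_qext _ (LinearMap.ext fun x => ?_))
    change Submodule.Quotient.mk (C.d i j x) = 0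
    rw [C.shape i j hij]
    rfl
  d_comp_d' i j k _ _ := by
    refine ModuleCat.hom_ext (Submodule.linearMap_qext _ (LinearMap.ext fun x => ?_))
    change Submodule.Quotient.mk (C.d j k (C.d i j x)) = 0
    rw [show C.d j k (C.d i j x) = 0 from ConcreteCategory.congr_hom (C.d_comp_d i j k) x]
    rfl

/-- The projection to the termwise quotient. -/
noncomputable def quotientComplexπ {W C : CochainComplex (ModuleCat.{w} R) ℤ} (ι : W ⟶ C) :
    C ⟶ quotientComplex ι where
  f _ := ofHom (Submodule.mkQ _)
  comm' _ _ _ := rfl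

theorem nonempty_resolutionStep [Small.{w} R] (W : CochainComplex (ModuleCat.{w} R) ℤ) :
    Nonempty (ResolutionStep W) := by
  obtain ⟨C, ι, h1, h2, h3, h4⟩ := exists_kInjective_embedding W
  have hv (p q : ℤ) (h : p + 1 = q) :
      ((Cochain.ofHom (quotientComplexπ ι)).rightShift (-1) 1 (by norm_num)).v p q h =
      (quotientComplexπ ι).f p ≫
        ((quotientComplex ι).shiftFunctorObjXIso (-1) q p (by omega)).inv := by
    rw [Cochain.rightShift_v _ _ _ _ p q h p (by omega), Cochain.ofHom_v]
  -- The shift by `-1` turns the projection into a cocycle of degree `1`, so that degree `n` of the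
  -- total complex is simply the product of the degree `n` terms.
  refine ⟨⟨C, ι, (quotientComplex ι)⟦(-1 : ℤ)⟧,
    (Cochain.ofHom (quotientComplexπ ι)).rightShift (-1) 1 (by norm_num), h1, h2, h3, h4,
    ?_, ?_, ?_⟩⟩
  · rw [Cochain.δ_rightShift _ _ _ _ _ 1 (by norm_num)]
    simp
  · intro p q h
    rw [hv]
    have hs : Function.Surjective
        ((quotientComplex ι).shiftFunctorObjXIso (-1) q p (by omega)).inv :=
      (ConcreteCategory.bijective_of_isIso _).2
    exact hs.comp (Submodule.mkQ_surjective (LinearMap.range (ι.f p).hom))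
  · intro p q h x
    rw [hv]
    have hi : Function.Injective
        ((quotientComplex ι).shiftFunctorObjXIso (-1) q p (by omega)).inv :=
      (ConcreteCategory.bijective_of_isIso _).1
    have : (ConcreteCategory.hom ((quotientComplexπ ι).f p ≫
        ((quotientComplex ι).shiftFunctorObjXIso (-1) q p (by omega)).inv)) x = 0 ↔
        (Submodule.mkQ (LinearMap.range (ι.f p).hom)) x = 0 :=
      map_eq_zero_iff ((quotientComplex ι).shiftFunctorObjXIso (-1) q p (by omega)).inv.hom hi
    rw [this, Submodule.mkQ_apply, Submodule.Quotient.mk_eq_zero]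
    rfl

/-- A choice of resolution step. -/
noncomputable def resolutionStep [Small.{w} R] (W : CochainComplex (ModuleCat.{w} R) ℤ) :
    ResolutionStep W :=
  (nonempty_resolutionStep W).some

/-- A sequence of complexes `Z p` embedded in K-injective complexes `C p` whose shifted
quotients are the complexes `Z (p + 1)`. -/
structure ResolutionSequence (R : Type u) [Ring R] extends TwistedSequence.{u, w} R where
  /-- the embedded complexes -/
  Z : ℕ → CochainComplex (ModuleCat.{w} R) ℤ
  /-- the embeddings -/
  ι : ∀ p, Z p ⟶ C p
  /-- the projections to the shifted quotients -/
  ψ : ∀ p, Cochain (C p) (Z (p + 1)) 1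
  φ_eq : ∀ p, φ p = (ψ p).comp (Cochain.ofHom (ι (p + 1))) (add_zero 1)
  ι_injective : ∀ p n, Function.Injective ((ι p).f n)
  exists_d_eq : ∀ (p : ℕ) (i j : ℤ) (x : (Z p).X j) (y : (C p).X i), i + 1 = j →
    (ι p).f j x = (C p).d i j y → ∃ x', (Z p).d i j x' = x
  δ_ψ : ∀ p, δ 1 2 (ψ p) = 0
  ψ_surjective : ∀ (p : ℕ) (i j : ℤ) (h : i + 1 = j), Function.Surjective ((ψ p).v i j h)
  ψ_eq_zero_iff : ∀ (p : ℕ) (i j : ℤ) (h : i + 1 = j) (x : (C p).X i),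
    (ψ p).v i j h x = 0 ↔ ∃ w, (ι p).f i w = x

namespace ResolutionSequence

variable (S : ResolutionSequence.{u, w} R)

lemma ψ_ι_apply (p : ℕ) (i j : ℤ) (h : i + 1 = j) (x : (S.Z p).X i) :
    (S.ψ p).v i j h ((S.ι p).f i x) = 0 :=
  (S.ψ_eq_zero_iff p i j h _).2 ⟨x, rfl⟩

lemma φ_apply (p : ℕ) (i j : ℤ) (h : i + 1 = j) (x : (S.C p).X i) :
    (S.φ p).v i j h x = (S.ι (p + 1)).f j ((S.ψ p).v i j h x) := by
  rw [S.φ_eq, Cochain.comp_zero_cochain_v, Cochain.ofHom_v]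
  rfl

/-- The embedding of `Z 0` into the total complex. -/
noncomputable def toTotal : S.Z 0 ⟶ S.total where
  f n := S.totalLift fun p => match p with
    | 0 => (S.ι 0).f n
    | _ + 1 => 0
  comm' i j hij := by
    replace hij : i + 1 = j := hij
    refine S.total_hom_ext fun p => ?_
    match p with
    | 0 =>
      rw [Category.assoc, Category.assoc, TwistedSequence.d_proj_zero _ i j hij]
      exact (S.ι 0).comm i j
    | 1 =>
      rw [Category.assoc, Category.assoc, TwistedSequence.d_proj_succ _ 0 i j hij]
      refine ModuleCat.hom_ext (LinearMap.ext fun x => ?_)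
      change (S.C 1).d i j 0 +
        (S.φ 0).v i j hij ((S.ι 0).f i x) = 0
      rw [φ_apply, map_zero, zero_add]
      have := S.ψ_ι_apply 0 i j hij x
      rw [this, map_zero]
    | p + 2 =>
      rw [Category.assoc, Category.assoc, TwistedSequence.d_proj_succ _ (p + 1) i j hij]
      refine ModuleCat.hom_ext (LinearMap.ext fun x => ?_)
      change (S.C (p + 2)).d i j 0 +
        (S.φ (p + 1)).v i j hij 0 = 0
      rw [map_zero, map_zero, zero_add]

/-- Exactness of `H(Z p) → H(C p) → H(C (p + 1))`, a consequence of the injectivity of `H(Z (p + 1))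
→ H(C (p + 1))`. -/
lemma exists_ι_add_d (p : ℕ) (i j k : ℤ) (hij : i + 1 = j) (hjk : j + 1 = k)
    (c : (S.C p).X j) (hc : (S.C p).d j k c = 0)
    (c' : (S.C (p + 1)).X j)
    (hc' : (S.φ p).v j k hjk c = (S.C (p + 1)).d j k c') :
    ∃ (x : (S.Z p).X j) (y : (S.C p).X i), (S.Z p).d j k x = 0 ∧
      c = (S.ι p).f j x + (S.C p).d i j y := by
  rw [φ_apply] at hc'
  obtain ⟨w, hw⟩ := S.exists_d_eq (p + 1) _ _ _ _ hjk hc'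
  obtain ⟨b, rfl⟩ := S.ψ_surjective p i j hij w
  change _ = (S.ψ p).v j k hjk c at hw
  have h1 : (S.ψ p).v j k hjk (c + (S.C p).d i j b) = 0 := by
    rw [map_add, apply_d_eq_neg_of_δ_eq_zero (S.δ_ψ p) i j k hij hjk b, ← hw]
    exact add_neg_cancel _
  obtain ⟨x, hx⟩ := (S.ψ_eq_zero_iff p j k hjk _).1 h1
  refine ⟨x, -b, ?_, ?_⟩
  · apply S.ι_injective p
    have h2 := ConcreteCategory.congr_hom ((S.ι p).comm j k) x
    have h3 := ConcreteCategory.congr_hom ((S.C p).d_comp_d i j k) b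
    change (S.C p).d j k ((S.ι p).f j x) = _ at h2
    change (S.C p).d j k ((S.C p).d i j b) = 0 at h3
    refine h2.symm.trans ?_
    rw [hx, map_add, hc, h3, map_zero, zero_add]
  · rw [hx, map_neg]
    abel

/-- Exactness of `H(C p) → H(C (p + 1)) → H(C (p + 2))`. Besides the previous lemma it needs
cocycles of `Z (p + 1)` to lift to cocycles of `C p`: the obstruction is a class of `Z p` that dies
in `C p`, hence is zero. -/
lemma exists_φ_add_d (p : ℕ) (i j k : ℤ) (hij : i + 1 = j) (hjk : j + 1 = k)
    (c : (S.C (p + 1)).X j) (hc : (S.C (p + 1)).d j k c = 0)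
    (c' : (S.C (p + 2)).X j)
    (hc' : (S.φ (p + 1)).v j k hjk c = (S.C (p + 2)).d j k c') :
    ∃ (b : (S.C p).X i) (y : (S.C (p + 1)).X i), (S.C p).d i j b = 0 ∧
      c = (S.φ p).v i j hij b + (S.C (p + 1)).d i j y := by
  obtain ⟨x, y, hx, rfl⟩ := S.exists_ι_add_d (p + 1) i j k hij hjk c hc c' hc'
  obtain ⟨b, rfl⟩ := S.ψ_surjective p i j hij x
  have h1 : (S.ψ p).v j k hjk ((S.C p).d i j b) = 0 := by
    rw [apply_d_eq_neg_of_δ_eq_zero (S.δ_ψ p) i j k hij hjk b, neg_eq_zero]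
    exact hx
  obtain ⟨w, hw⟩ := (S.ψ_eq_zero_iff p j k hjk _).1 h1
  obtain ⟨w', rfl⟩ := S.exists_d_eq p _ _ _ _ hij hw
  refine ⟨b - (S.ι p).f i w', y, ?_, ?_⟩
  · rw [map_sub, ← hw, sub_eq_zero]
    exact (ConcreteCategory.congr_hom ((S.ι p).comm i j) w').symm
  · rw [φ_apply, map_sub, ψ_ι_apply, sub_zero]

instance quasiIso_toTotal : QuasiIso S.toTotal := by
  rw [quasiIso_iff_elements]
  intro i j k hij hjk
  have hd0 (i j : ℤ) (h : i + 1 = j) (y : S.total.X i) :=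
    ConcreteCategory.congr_hom (S.d_proj_zero i j h) y
  have hds (p : ℕ) (i j : ℤ) (h : i + 1 = j) (y : S.total.X i) :=
    ConcreteCategory.congr_hom (S.d_proj_succ p i j h) y
  constructor
  · intro x y hx hxy
    refine S.exists_d_eq 0 i j x (S.proj 0 i y) hij ?_
    exact (congrArg (S.proj 0 j) hxy).trans (hd0 i j hij y)
  · intro y hy
    let κ (p : ℕ) : (S.C p).X j := S.proj p j y
    have hκ0 : (S.C 0).d j k (κ 0) = 0 :=
      (hd0 j k hjk y).symm.trans ((congrArg (S.proj 0 k) hy).trans (map_zero _))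
    have hκs (p : ℕ) : (S.C (p + 1)).d j k (κ (p + 1)) +
        (S.φ p).v j k hjk (κ p) = 0 :=
      (hds p j k hjk y).symm.trans
        ((congrArg (S.proj (p + 1) k) hy).trans (map_zero _))
    have hκs' (p : ℕ) : (S.φ p).v j k hjk (κ p) =
        (S.C (p + 1)).d j k (-κ (p + 1)) := by
      rw [map_neg]
      exact eq_neg_of_add_eq_zero_right (hκs p)
    obtain ⟨x, c₀, hx, hc₀⟩ := S.exists_ι_add_d 0 i j k hij hjk (κ 0) hκ0 _ (hκs' 0)
    let P (p : ℕ) (c : (S.C p).X i) : Prop :=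
      (S.φ p).v j k hjk (κ p - (S.C p).d i j c) = 0
    have hP0 : P 0 c₀ := by
      simp only [P]
      rw [hc₀, add_sub_cancel_right, φ_apply, ψ_ι_apply, map_zero]
    have hφd (p : ℕ) (c : (S.C p).X i) :
        (S.φ p).v j k hjk ((S.C p).d i j c) =
        - (S.C (p + 1)).d j k ((S.φ p).v i j hij c) :=
      apply_d_eq_neg_of_δ_eq_zero (S.δ_φ p) i j k hij hjk c
    have hφφ (p : ℕ) (c : (S.C p).X i) :
        (S.φ (p + 1)).v j k hjk ((S.φ p).v i j hij c) =
          0 := by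
      rw [φ_apply, φ_apply, ψ_ι_apply, map_zero]
    have hstep (p : ℕ) (c : (S.C p).X i) (hc : P p c) :
        ∃ (b : (S.C p).X i) (c' : (S.C (p + 1)).X i),
          (S.C p).d i j b = 0 ∧
          κ (p + 1) - (S.φ p).v i j hij c =
            (S.φ p).v i j hij b + (S.C (p + 1)).d i j c' := by
      refine S.exists_φ_add_d p i j k hij hjk
        (κ (p + 1) - (S.φ p).v i j hij c) ?_ (-κ (p + 2)) ?_
      · simp only [P] at hc
        rw [map_sub, hφd] at hc
        have h1 := hκs p
        rw [map_sub]
        rw [eq_neg_of_add_eq_zero_left h1, sub_eq_zero.1 hc, neg_neg, sub_self]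
      · rw [map_sub, hφφ, sub_zero]
        exact hκs' (p + 1)
    have hP (p : ℕ) (c b : (S.C p).X i) (c' : (S.C (p + 1)).X i)
        (h : κ (p + 1) - (S.φ p).v i j hij c =
            (S.φ p).v i j hij b + (S.C (p + 1)).d i j c') :
        P (p + 1) c' := by
      simp only [P]
      have : κ (p + 1) - (S.C (p + 1)).d i j c' =
          (S.φ p).v i j hij (b + c) := by
        rw [map_add]
        rw [sub_eq_iff_eq_add] at h ⊢
        rw [h]
        exact (by abel)
      rw [this, hφφ]
    let c : ∀ p, {c : (S.C p).X i // P p c} := fun p =>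
      Nat.rec ⟨c₀, hP0⟩ (fun p c => ⟨(hstep p c.1 c.2).choose_spec.choose,
        hP p c.1 _ _ (hstep p c.1 c.2).choose_spec.choose_spec.2⟩) p
    let b (p : ℕ) : (S.C p).X i := (hstep p (c p).1 (c p).2).choose
    have hb (p : ℕ) : (S.C p).d i j (b p) = 0 :=
      (hstep p (c p).1 (c p).2).choose_spec.choose_spec.1
    have hc (p : ℕ) : κ (p + 1) - (S.φ p).v i j hij (c p).1 =
        (S.φ p).v i j hij (b p) +
          (S.C (p + 1)).d i j (c (p + 1)).1 :=
      (hstep p (c p).1 (c p).2).choose_spec.choose_spec.2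
    -- The correction `b p` serves to solve the equation in component `p + 1`. Being a cocycle, it
    -- does not disturb the equation in component `p`, so each component is corrected only once and
    -- the recursion defines an element of the product.
    refine ⟨x, S.totalMk (fun p => (c p).1 + b p), hx, ?_⟩
    refine TwistedSequence.total_ext fun p => ?_
    rw [map_add]
    match p with
    | 0 =>
      refine (congrArg (_ + ·) (hd0 i j hij _)).trans ?_
      change (S.ι 0).f j x + (S.C 0).d i j ((c 0).1 + b 0) = κ 0
      rw [map_add, hb, add_zero, hc₀]
      rfl
    | p + 1 =>
      refine (congrArg (_ + ·) (hds p i j hij _)).trans ?_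
      change 0 + ((S.C (p + 1)).d i j ((c (p + 1)).1 + b (p + 1)) +
        (S.φ p).v i j hij ((c p).1 + b p)) = κ (p + 1)
      rw [map_add, hb, add_zero, map_add, zero_add, eq_add_of_sub_eq (hc p)]
      exact (by abel)

end ResolutionSequence

variable [Small.{w} R] (W : CochainComplex (ModuleCat.{w} R) ℤ)

/-- The iterated shifted quotients. -/
noncomputable def syzygy : ℕ → CochainComplex (ModuleCat.{w} R) ℤ
  | 0 => W
  | p + 1 => (resolutionStep (syzygy p)).next

/-- The projection to the next iterated quotient. -/
noncomputable def syzygyψ (p : ℕ) :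
    Cochain (resolutionStep (syzygy W p)).C (syzygy W (p + 1)) 1 :=
  (resolutionStep (syzygy W p)).ψ

/-- The sequence of K-injective complexes that resolves `W`. -/
noncomputable def resolutionSequence : ResolutionSequence.{u, w} R where
  C p := (resolutionStep (syzygy W p)).C
  φ p := (syzygyψ W p).comp (Cochain.ofHom (resolutionStep (syzygy W (p + 1))).ι) (add_zero 1)
  δ_φ p := by
    have h : δ 1 2 (syzygyψ W p) = 0 := (resolutionStep (syzygy W p)).δ_ψ
    rw [δ_comp_ofHom, h, Cochain.zero_comp]
  φ_φ p := by
    ext i k hik : 1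
    rw [Cochain.comp_v _ _ _ i (i + 1) k rfl (by omega)]
    refine ModuleCat.hom_ext (LinearMap.ext fun x => ?_)
    simp only [Cochain.comp_zero_cochain_v, Cochain.ofHom_v]
    have h (y) : (syzygyψ W (p + 1)).v (i + 1) k (by omega)
        ((resolutionStep (syzygy W (p + 1))).ι.f (i + 1) y) = 0 :=
      ((resolutionStep (syzygy W (p + 1))).ψ_eq_zero_iff _ _ _ _).2 ⟨y, rfl⟩
    exact (congrArg ((resolutionStep (syzygy W (p + 1 + 1))).ι.f k) (h _)).trans (map_zero _)
  Z := syzygy W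
  ι p := (resolutionStep (syzygy W p)).ι
  ψ := syzygyψ W
  φ_eq _ := rfl
  ι_injective p := (resolutionStep (syzygy W p)).ι_injective
  exists_d_eq p := (resolutionStep (syzygy W p)).exists_d_eq
  δ_ψ p := (resolutionStep (syzygy W p)).δ_ψ
  ψ_surjective p := (resolutionStep (syzygy W p)).ψ_surjective
  ψ_eq_zero_iff p := (resolutionStep (syzygy W p)).ψ_eq_zero_iff

/-- Every complex of modules has a K-injective resolution whose terms are injective. -/
theorem exists_kInjective_resolution : ∃ (K : CochainComplex (ModuleCat.{w} R) ℤ) (ι : W ⟶ K),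
    QuasiIso ι ∧ K.IsKInjective ∧ ∀ n, Injective (K.X n) := by
  let S := resolutionSequence W
  have h1 : ∀ p, (S.C p).IsKInjective := fun p => (resolutionStep (syzygy W p)).isKInjective
  have h2 : ∀ p n, Injective ((S.C p).X n) := fun p => (resolutionStep (syzygy W p)).injective_X
  exact ⟨_, S.toTotal, S.quasiIso_toTotal, TwistedSequence.isKInjective_total _,
    TwistedSequence.injective_total_X _⟩

end ModuleCat

/-! ### Modules with acyclic `Hom` complex into a complex of injectives -/

section HomAcyclic

variable {A : Type u} [Ring A]

/-- The complex `Hom(N, J)` is acyclic. -/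
def HomAcyclic (J : CochainComplex (ModuleCat.{u} A) ℤ) (N : Type w) [AddCommGroup N]
    [Module A N] : Prop :=
  ∀ (i j k : ℤ), i + 1 = j → j + 1 = k → ∀ f : N →ₗ[A] J.X j, (∀ x, J.d j k (f x) = 0) →
    ∃ h : N →ₗ[A] J.X i, ∀ x, J.d i j (h x) = f x

lemma LinearMap.exists_comp_eq_of_surjective {M : Type*} {N N'' : Type*} [AddCommGroup M]
    [AddCommGroup N] [AddCommGroup N''] [Module A M] [Module A N] [Module A N'']
    (g : N →ₗ[A] N'') (hg : Function.Surjective g) (a : N →ₗ[A] M)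
    (ha : ∀ x, g x = 0 → a x = 0) : ∃ b : N'' →ₗ[A] M, ∀ x, b (g x) = a x := by
  refine ⟨(LinearMap.ker g).liftQ a ha ∘ₗ (g.quotKerEquivOfSurjective hg).symm, fun x => ?_⟩
  have : (g.quotKerEquivOfSurjective hg).symm (g x) = Submodule.Quotient.mk x := by
    rw [LinearEquiv.symm_apply_eq]
    rfl
  exact (congrArg ((LinearMap.ker g).liftQ a ha) this).trans (Submodule.liftQ_apply _ _ _)

lemma ModuleCat.exists_extend_of_injective (M : ModuleCat.{u} A) [Injective M] {N' N : Type u}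
    [AddCommGroup N'] [AddCommGroup N] [Module A N'] [Module A N] (f : N' →ₗ[A] N)
    (hf : Function.Injective f) (a : N' →ₗ[A] M) : ∃ b : N →ₗ[A] M, ∀ x, b (f x) = a x := by
  have : Mono (ofHom f) := (ModuleCat.mono_iff_injective _).2 hf
  exact ⟨(Injective.factorThru (ofHom a) (ofHom f)).hom,
    fun x => ConcreteCategory.congr_hom (Injective.comp_factorThru (ofHom a) (ofHom f)) x⟩

namespace HomAcyclic

variable {J : CochainComplex (ModuleCat.{u} A) ℤ}

lemma of_retract {M : Type*} {N : Type*} [AddCommGroup M] [AddCommGroup N] [Module A M]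
    [Module A N] (hM : HomAcyclic J M) (i : N →ₗ[A] M) (r : M →ₗ[A] N) (hri : ∀ x, r (i x) = x) :
    HomAcyclic J N := by
  intro a b c hab hbc f hf
  obtain ⟨h, hh⟩ := hM a b c hab hbc (f ∘ₗ r) (fun x => hf _)
  exact ⟨h ∘ₗ i, fun x => by simp [hh, hri]⟩

lemma pi {ι : Type*} [Finite ι] {N : ι → Type*} [∀ i, AddCommGroup (N i)] [∀ i, Module A (N i)]
    (hN : ∀ i, HomAcyclic J (N i)) : HomAcyclic J (∀ i, N i) := by
  classical
  have := Fintype.ofFinite ι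
  intro a b c hab hbc f hf
  choose h hh using fun i => hN i a b c hab hbc (f ∘ₗ LinearMap.single A N i) (fun x => hf _)
  refine ⟨∑ i, h i ∘ₗ LinearMap.proj i, fun x => ?_⟩
  simp only [LinearMap.sum_apply, LinearMap.comp_apply, LinearMap.proj_apply, map_sum, hh]
  rw [← map_sum]
  congr 1
  exact Finset.univ_sum_single x

variable [∀ n, Injective (J.X n)] {N' N : Type u} {N'' : Type w} [AddCommGroup N']
  [AddCommGroup N] [AddCommGroup N''] [Module A N'] [Module A N] [Module A N'']

/-- As the terms of `J` are injective, `Hom(-, J)` sends the short exact sequence to one of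
complexes; this and the next lemma are two cases of the long exact cohomology sequence. -/
lemma of_extension (h' : HomAcyclic J N') (h'' : HomAcyclic J N'') (f : N' →ₗ[A] N)
    (g : N →ₗ[A] N'') (hf : Function.Injective f) (hg : Function.Surjective g)
    (hfg : Function.Exact f g) : HomAcyclic J N := by
  intro i j k hij hjk a ha
  obtain ⟨l', hl'⟩ := h' i j k hij hjk (a ∘ₗ f) (fun x => ha _)
  obtain ⟨l, hl⟩ := ModuleCat.exists_extend_of_injective _ f hf l'
  obtain ⟨b, hb⟩ := LinearMap.exists_comp_eq_of_surjective g hg (a - (J.d i j).hom ∘ₗ l) (by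
    intro x hx
    obtain ⟨y, rfl⟩ := (hfg x).1 hx
    simpa [hl, sub_eq_zero] using (hl' y).symm)
  obtain ⟨m, hm⟩ := h'' i j k hij hjk b (by
    intro x
    obtain ⟨y, rfl⟩ := hg x
    rw [hb]
    have := ConcreteCategory.congr_hom (J.d_comp_d i j k) (l y)
    have h2 : J.d j k (J.d i j (l y)) = 0 := this
    change J.d j k (a y - J.d i j (l y)) = 0
    rw [map_sub, ha, h2, sub_zero])
  refine ⟨l + m ∘ₗ g, fun x => ?_⟩
  change J.d i j (l x + m (g x)) = _
  rw [map_add, hm, hb]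
  exact add_sub_cancel _ _

lemma of_quotient (h' : HomAcyclic J N') (h : HomAcyclic J N) (f : N' →ₗ[A] N)
    (g : N →ₗ[A] N'') (hf : Function.Injective f) (hg : Function.Surjective g)
    (hfg : Function.Exact f g) : HomAcyclic J N'' := by
  intro i j k hij hjk a ha
  obtain ⟨l, hl⟩ := h i j k hij hjk (a ∘ₗ g) (fun x => ha _)
  -- The lift `l` need not vanish on `N'`, but its restriction there is a cocycle, hence a boundary;
  -- extending the bounding map to `N` allows `l` to be corrected so that it descends to `N''`.
  obtain ⟨m', hm'⟩ := h' (i - 1) i j (by omega) hij (l ∘ₗ f) (by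
    intro x
    simp [hl, hfg.apply_apply_eq_zero])
  obtain ⟨m, hm⟩ := ModuleCat.exists_extend_of_injective _ f hf m'
  obtain ⟨b, hb⟩ := LinearMap.exists_comp_eq_of_surjective g hg
    (l - (J.d (i - 1) i).hom ∘ₗ m) (by
    intro x hx
    obtain ⟨y, rfl⟩ := (hfg x).1 hx
    simpa [hm, sub_eq_zero] using (hm' y).symm)
  refine ⟨b, fun x => ?_⟩
  obtain ⟨y, rfl⟩ := hg x
  rw [hb]
  have h2 : J.d i j (J.d (i - 1) i (m y)) = 0 :=
    ConcreteCategory.congr_hom (J.d_comp_d (i - 1) i j) (m y)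
  change J.d i j (l y - J.d (i - 1) i (m y)) = _
  rw [map_sub, h2, sub_zero, hl]
  rfl

end HomAcyclic

/-- `Hom(A ε, J)` is `ε J`, so it suffices that `ε` annihilates the cohomology of `J`. -/
lemma homAcyclic_span_singleton {J : CochainComplex (ModuleCat.{u} A) ℤ} {ε : A}
    (hε : IsIdempotentElem ε)
    (hJ : ∀ (i j k : ℤ), i + 1 = j → j + 1 = k → ∀ z : J.X j, J.d j k z = 0 →
      ∃ y, J.d i j y = ε • z) : HomAcyclic J (Submodule.span A {ε}) := by
  intro i j k hij hjk f hf
  obtain ⟨y, hy⟩ := hJ i j k hij hjk (f ⟨ε, Submodule.mem_span_singleton_self ε⟩) (hf _)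
  refine ⟨LinearMap.toSpanSingleton A _ y ∘ₗ Submodule.subtype _, ?_⟩
  rintro ⟨r, hr⟩
  obtain ⟨a, rfl⟩ := Submodule.mem_span_singleton.1 hr
  change J.d i j ((a • ε) • y) = _
  have hε' : (a • ε) * ε = a • ε := by rw [smul_eq_mul, mul_assoc, hε.eq]
  rw [map_smul, hy, smul_smul, hε', ← map_smul]
  exact congrArg f (Subtype.ext hε')

end HomAcyclic

/-! ### Filtrations by standard modules and the trace of an idempotent -/

section Trace

variable {A : Type u} [Ring A]

/-- The submodule `A ε N` of `N`. -/
def traceSubmodule (ε : A) (N : Type*) [AddCommGroup N] [Module A N] : Submodule A N :=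
  Submodule.span A (Set.range fun n : N => ε • n)

lemma smul_mem_traceSubmodule (ε : A) {N : Type*} [AddCommGroup N] [Module A N] (n : N) :
    ε • n ∈ traceSubmodule ε N :=
  Submodule.subset_span ⟨n, rfl⟩

lemma traceSubmodule_le_iff {ε : A} {N : Type*} [AddCommGroup N] [Module A N]
    {P : Submodule A N} : traceSubmodule ε N ≤ P ↔ ∀ n : N, ε • n ∈ P := by
  rw [traceSubmodule, Submodule.span_le]
  exact ⟨fun h n => h ⟨n, rfl⟩, by rintro h _ ⟨n, rfl⟩; exact h n⟩

lemma map_mem_traceSubmodule {ε : A} {M N : Type*} [AddCommGroup M] [AddCommGroup N] [Module A M]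
    [Module A N] (f : M →ₗ[A] N) {m : M} (hm : m ∈ traceSubmodule ε M) :
    f m ∈ traceSubmodule ε N := by
  have : traceSubmodule ε M ≤ (traceSubmodule ε N).comap f :=
    traceSubmodule_le_iff.2 fun n => by
      rw [Submodule.mem_comap, map_smul]
      exact smul_mem_traceSubmodule _ _
  exact this hm

/-- `N` is a direct summand of a finite product of modules `V γ` with `γ ∈ S`. -/
def IsRetractOfProd {Γ : Type v} (V : Γ → Type u) [∀ γ, AddCommGroup (V γ)] [∀ γ, Module A (V γ)]
    (S : Set Γ) (N : Type u) [AddCommGroup N] [Module A N] : Prop :=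
  ∃ (ι : Type) (_ : Finite ι) (γ : ι → Γ) (i : N →ₗ[A] ∀ j, V (γ j)) (r : (∀ j, V (γ j)) →ₗ[A] N),
    (∀ j, γ j ∈ S) ∧ ∀ x, r (i x) = x

/-- `N` has a filtration of length `n` whose successive quotients are direct summands of finite
products of modules `V γ` with `γ ∈ S`. -/
def IsFiltered {Γ : Type v} (V : Γ → Type u) [∀ γ, AddCommGroup (V γ)] [∀ γ, Module A (V γ)]
    (S : Set Γ) : ℕ → ModuleCat.{u} A → Prop
  | 0, N => Subsingleton N
  | n + 1, N => ∃ (N' G : ModuleCat.{u} A) (i : N' →ₗ[A] N) (p : N →ₗ[A] G),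
      Function.Injective i ∧ Function.Surjective p ∧ Function.Exact i p ∧
        IsFiltered V S n N' ∧ IsRetractOfProd (A := A) V S G

section

variable {Γ : Type v} {V : Γ → Type u} [∀ γ, AddCommGroup (V γ)] [∀ γ, Module A (V γ)]

lemma IsFiltered.of_equiv {S : Set Γ} {n : ℕ} {N M : ModuleCat.{u} A} (h : IsFiltered V S n N)
    (e : N ≃ₗ[A] M) : IsFiltered V S n M := by
  match n, h with
  | 0, h =>
    have : Subsingleton N := h
    exact e.symm.toEquiv.subsingleton
  | n + 1, h =>
    obtain ⟨N', G, i, p, hi, hp, hip, h1, h2⟩ := h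
    refine ⟨N', G, e.toLinearMap ∘ₗ i, p ∘ₗ e.symm.toLinearMap, e.injective.comp hi,
      hp.comp e.symm.surjective, fun x => ?_, h1, h2⟩
    refine (hip (e.symm x)).trans ?_
    constructor
    · rintro ⟨y, hy⟩
      exact ⟨y, by simp [hy]⟩
    · rintro ⟨y, rfl⟩
      exact ⟨y, by simp⟩

lemma HasFiltrationBy.isFiltered {M : Type u} [AddCommGroup M] [Module A M]
    (h : HasFiltrationBy (A := A) V M) : ∃ n, IsFiltered V Set.univ n (ModuleCat.of A M) := by
  obtain ⟨n, F, hmono, h0, hlast, k, γ, ⟨φ⟩⟩ := h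
  have key (m : ℕ) (hm : m < n + 1) :
      IsFiltered V Set.univ m (ModuleCat.of A (F ⟨m, hm⟩)) := by
    induction m with
    | zero =>
      change Subsingleton (F 0)
      rw [h0]
      infer_instance
    | succ m ih =>
      let i : Fin n := ⟨m, by omega⟩
      have hle : F i.castSucc ≤ F i.succ := hmono (Fin.castSucc_lt_succ).le
      refine ⟨ModuleCat.of A (F i.castSucc),
        ModuleCat.of A (F i.succ ⧸ (F i.castSucc).submoduleOf (F i.succ)),
        Submodule.inclusion hle, Submodule.mkQ _, Submodule.inclusion_injective hle,
        Submodule.mkQ_surjective _, ?_, ih (by omega), ?_⟩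
      · intro x
        rw [Submodule.mkQ_apply, Submodule.Quotient.mk_eq_zero, Submodule.submoduleOf,
          Submodule.mem_comap]
        constructor
        · intro hx
          exact ⟨⟨x, hx⟩, rfl⟩
        · rintro ⟨y, rfl⟩
          exact y.2
      -- Only the whole graded module is a product of modules `V γ`; a single layer is a direct
      -- summand of it, which is why retracts of products are used.
      · refine ⟨Fin k, inferInstance, γ, φ.toLinearMap ∘ₗ LinearMap.single A
            (fun i : Fin n => F i.succ ⧸ (F i.castSucc).submoduleOf (F i.succ)) i,
          LinearMap.proj i ∘ₗ φ.symm.toLinearMap, fun _ => Set.mem_univ _, fun x => ?_⟩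
        simp
  refine ⟨n, (key n (by omega)).of_equiv ?_⟩
  have : F ⟨n, by omega⟩ = ⊤ := hlast
  exact (LinearEquiv.ofEq _ _ this).trans Submodule.topEquiv

lemma IsRetractOfProd.of_add {S : Set Γ} {M M' N : Type u} [AddCommGroup M] [AddCommGroup M']
    [AddCommGroup N] [Module A M] [Module A M'] [Module A N]
    (h : IsRetractOfProd (A := A) V S M) (h' : IsRetractOfProd (A := A) V S M')
    (a : N →ₗ[A] M) (b : N →ₗ[A] M') (c : M →ₗ[A] N) (d : M' →ₗ[A] N)
    (hac : ∀ x, c (a x) + d (b x) = x) : IsRetractOfProd (A := A) V S N := by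
  obtain ⟨ι, _, γ, i, r, hγ, hri⟩ := h
  obtain ⟨ι', _, γ', i', r', hγ', hri'⟩ := h'
  refine ⟨ι ⊕ ι', inferInstance, Sum.elim γ γ',
    LinearMap.pi fun j => match j with
      | .inl j => LinearMap.proj j ∘ₗ i ∘ₗ a
      | .inr j => LinearMap.proj j ∘ₗ i' ∘ₗ b,
    c ∘ₗ r ∘ₗ LinearMap.pi (fun j => LinearMap.proj (Sum.inl j)) +
      d ∘ₗ r' ∘ₗ LinearMap.pi (fun j => LinearMap.proj (Sum.inr j)), ?_, fun x => ?_⟩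
  · rintro (j | j)
    · exact hγ j
    · exact hγ' j
  · change c (r (i (a x))) + d (r' (i' (b x))) = x
    rw [hri, hri', hac]

/-- The inclusion of the factors indexed by a subtype in a product. -/
noncomputable def extendByZero {ι : Type*} (W : ι → Type*) [∀ i, AddCommGroup (W i)]
    [∀ i, Module A (W i)] (P : ι → Prop) : (∀ j : {j // P j}, W j) →ₗ[A] ∀ j, W j :=
  open Classical in
  LinearMap.pi fun j => if h : P j then LinearMap.proj (⟨j, h⟩ : {j // P j}) else 0

lemma extendByZero_of_pos {ι : Type*} {W : ι → Type*} [∀ i, AddCommGroup (W i)]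
    [∀ i, Module A (W i)] (P : ι → Prop) (x : ∀ j : {j // P j}, W j) {j : ι} (h : P j) :
    extendByZero (A := A) W P x j = x ⟨j, h⟩ := by
  simp [extendByZero, h]

lemma extendByZero_of_neg {ι : Type*} {W : ι → Type*} [∀ i, AddCommGroup (W i)]
    [∀ i, Module A (W i)] (P : ι → Prop) (x : ∀ j : {j // P j}, W j) {j : ι} (h : ¬ P j) :
    extendByZero (A := A) W P x j = 0 := by
  simp [extendByZero, h]

/-- The projection to the factors indexed by a subtype. -/
def restrictFactors {ι : Type*} (W : ι → Type*) [∀ i, AddCommGroup (W i)]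
    [∀ i, Module A (W i)] (P : ι → Prop) : (∀ j, W j) →ₗ[A] (∀ j : {j // P j}, W j) :=
  LinearMap.pi fun j => LinearMap.proj j.1

/-! ### Splitting off the trace of an idempotent -/

section

variable {ε : A} {x : Γ} {S : Set Γ} (hx : traceSubmodule ε (V x) = ⊤)
  (hS : ∀ z ∈ S, ∀ v : V z, ε • v = 0)

include hx in
lemma extendByZero_mem_traceSubmodule {ι : Type*} [Finite ι] (γ : ι → Γ)
    (m : ∀ j : {j // γ j = x}, V (γ j)) :
    extendByZero (A := A) (fun j => V (γ j)) (fun j => γ j = x) m ∈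
      traceSubmodule ε (∀ j, V (γ j)) := by
  classical
  have := Fintype.ofFinite ι
  have hx' (y) (hy : y = x) (v : V y) : v ∈ traceSubmodule ε (V y) := by
    subst hy
    rw [hx]
    trivial
  rw [← Finset.univ_sum_single (extendByZero (A := A) (fun j => V (γ j)) (fun j => γ j = x) m)]
  refine Submodule.sum_mem _ fun j _ => ?_
  by_cases h : γ j = x
  · exact map_mem_traceSubmodule (LinearMap.single A (fun j => V (γ j)) j) (hx' _ h _)
  · rw [extendByZero_of_neg (fun j => γ j = x) _ h, Pi.single_zero]
    exact Submodule.zero_mem _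

include hS in
lemma apply_eq_zero_of_mem_traceSubmodule {ι : Type*} (γ : ι → Γ)
    (hγ : ∀ j, γ j ∈ insert x S) {t : ∀ j, V (γ j)} (ht : t ∈ traceSubmodule ε (∀ j, V (γ j)))
    (j : ι) (hj : γ j ≠ x) : t j = 0 := by
  have : traceSubmodule ε (∀ j, V (γ j)) ≤ LinearMap.ker (LinearMap.proj (R := A) j) :=
    traceSubmodule_le_iff.2 fun n => hS _ ((hγ j).resolve_left hj) (n j)
  exact this ht

include hx hS in
-- In the product, `hS` and `hx` make the trace equal to the subproduct of the factors with `γ j =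
-- x`. Linear maps preserve traces, so the retraction restricts.
lemma IsRetractOfProd.trace {G : Type u} [AddCommGroup G] [Module A G]
    (h : IsRetractOfProd (A := A) V (insert x S) G) :
    IsRetractOfProd (A := A) V {x} (traceSubmodule ε G) := by
  obtain ⟨ι, _, γ, i, r, hγ, hri⟩ := h
  refine ⟨{j // γ j = x}, inferInstance, fun j => γ j.1,
    restrictFactors (fun j => V (γ j)) (fun j => γ j = x) ∘ₗ i ∘ₗ Submodule.subtype _,
    (r ∘ₗ extendByZero (fun j => V (γ j)) (fun j => γ j = x)).codRestrict _ (fun m =>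
      map_mem_traceSubmodule r (extendByZero_mem_traceSubmodule hx γ m)),
    fun j => j.2, ?_⟩
  rintro ⟨k, hk⟩
  apply Subtype.ext
  change r (extendByZero (A := A) (fun j => V (γ j)) _ (restrictFactors (A := A)
    (fun j => V (γ j)) (fun j => γ j = x) (i k))) = k
  conv_rhs => rw [← hri k]
  congr 1
  funext j
  by_cases hj : γ j = x
  · rw [extendByZero_of_pos (fun j => γ j = x) _ hj]
    rfl
  · rw [extendByZero_of_neg (fun j => γ j = x) _ hj,
      apply_eq_zero_of_mem_traceSubmodule hS γ hγ (map_mem_traceSubmodule i hk) j hj]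

include hx hS in
lemma IsRetractOfProd.quotient_trace {G : Type u} [AddCommGroup G] [Module A G]
    (h : IsRetractOfProd (A := A) V (insert x S) G) :
    IsRetractOfProd (A := A) V S (G ⧸ traceSubmodule ε G) := by
  obtain ⟨ι, _, γ, i, r, hγ, hri⟩ := h
  refine ⟨{j // γ j ≠ x}, inferInstance, fun j => γ j.1,
    (traceSubmodule ε G).liftQ
      (restrictFactors (fun j => V (γ j)) (fun j => γ j ≠ x) ∘ₗ i) ?_,
    Submodule.mkQ _ ∘ₗ r ∘ₗ extendByZero (fun j => V (γ j)) (fun j => γ j ≠ x), fun j => (hγ j.1).resolve_left j.2, ?_⟩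
  · intro k hk
    funext j
    exact apply_eq_zero_of_mem_traceSubmodule hS γ hγ (map_mem_traceSubmodule i hk) j.1 j.2
  · intro q
    obtain ⟨g, rfl⟩ := Submodule.mkQ_surjective _ q
    change Submodule.mkQ _ (r (extendByZero (A := A) (fun j => V (γ j)) (fun j => γ j ≠ x)
      (restrictFactors (A := A) _ _ (i g)))) = _
    rw [← sub_eq_zero, ← map_sub, Submodule.mkQ_apply, Submodule.Quotient.mk_eq_zero]
    rw [← neg_mem_iff, neg_sub]
    conv in g - _ => rw [← hri g]
    rw [← map_sub]
    have : i g - extendByZero (A := A) (fun j => V (γ j)) (fun j => γ j ≠ x)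
        (restrictFactors (A := A) _ _ (i g)) =
        extendByZero (A := A) (fun j => V (γ j)) (fun j => γ j = x)
          (restrictFactors (A := A) _ _ (i g)) := by
      funext j
      by_cases hj : γ j = x
      · rw [Pi.sub_apply, extendByZero_of_pos (fun j => γ j = x) _ hj,
          extendByZero_of_neg (fun j => γ j ≠ x) _ (not_not.2 hj), sub_zero]
        rfl
      · rw [Pi.sub_apply, extendByZero_of_neg (fun j => γ j = x) _ hj,
          extendByZero_of_pos (fun j => γ j ≠ x) _ hj]
        exact sub_self _
    rw [hri, this]
    exact map_mem_traceSubmodule r (extendByZero_mem_traceSubmodule hx γ _)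

/-- Maps from `V x` lift along surjections between modules satisfying `Q`. -/
def LiftsAlong (M : Type u) [AddCommGroup M] [Module A M] (Q : ModuleCat.{u} A → Prop) : Prop :=
  ∀ (N G : ModuleCat.{u} A), Q N → ∀ p : N →ₗ[A] G, Function.Surjective p →
    ∀ f : M →ₗ[A] G, ∃ g : M →ₗ[A] N, ∀ x, p (g x) = f x

lemma IsRetractOfProd.liftsAlong {Q : ModuleCat.{u} A → Prop} {K : Type u} [AddCommGroup K]
    [Module A K] (hK : IsRetractOfProd (A := A) V {x} K) (hQ : LiftsAlong (A := A) (V x) Q) :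
    LiftsAlong K Q := by
  classical
  obtain ⟨ι, _, γ, i, r, hγ, hri⟩ := hK
  have := Fintype.ofFinite ι
  obtain rfl : γ = fun _ => x := funext hγ
  intro N G hN p hp f
  choose g hg using fun j => hQ N G hN p hp (f ∘ₗ r ∘ₗ LinearMap.single A (fun _ => V x) j)
  refine ⟨(∑ j, g j ∘ₗ LinearMap.proj j) ∘ₗ i, fun k => ?_⟩
  simp only [LinearMap.comp_apply, LinearMap.sum_apply, LinearMap.proj_apply, map_sum, hg]
  rw [← map_sum, ← map_sum]
  conv_rhs => rw [← hri k]
  congr 2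
  exact Finset.univ_sum_single (i k)

include hx hS in
-- Taking the trace need not preserve short exact sequences. Here the trace of the top layer is a
-- summand of a power of `V x`, so it lifts back into `N`; this splits the trace of `N` into those
-- of `N'` and `G` and makes the sequence of quotients exact. The property `Q` records the class of
-- modules over which `V x` is projective.
theorem IsFiltered.trace {Q : ModuleCat.{u} A → Prop} (hε : IsIdempotentElem ε)
    (hQ : LiftsAlong (A := A) (V x) Q)
    (hQsub : ∀ (N' N : ModuleCat.{u} A) (i : N' →ₗ[A] N), Function.Injective i → Q N → Q N')
    (n : ℕ) (N : ModuleCat.{u} A) (hN : Q N) (h : IsFiltered V (insert x S) n N) :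
    IsRetractOfProd (A := A) V {x} (traceSubmodule ε N) ∧
      IsFiltered V S n (ModuleCat.of A (N ⧸ traceSubmodule ε N)) := by
  induction n generalizing N with
  | zero =>
    have : Subsingleton N := h
    refine ⟨⟨Fin 0, inferInstance, Fin.elim0, 0, 0, fun j => j.elim0,
      fun _ => Subsingleton.elim _ _⟩, ?_⟩
    exact (Submodule.mkQ_surjective _).subsingleton
  | succ n ih =>
    obtain ⟨N', G, i, p, hi, hp, hip, h1, h2⟩ := h
    obtain ⟨hK', hN'⟩ := ih N' (hQsub _ _ i hi hN) h1
    have hK := h2.trace hx hS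
    obtain ⟨s, hs⟩ := hK.liftsAlong hQ N G hN p hp (Submodule.subtype _)
    -- A generator satisfies `ε • g = ε • (ε • g)`, so its image under `s` is again a multiple by
    -- `ε`.
    have hsmem (k) : s k ∈ traceSubmodule ε N := by
      have hle : traceSubmodule ε G ≤
          ((traceSubmodule ε N).comap s).map (Submodule.subtype _) := by
        refine traceSubmodule_le_iff.2 fun g => ?_
        refine ⟨⟨ε • g, smul_mem_traceSubmodule _ _⟩, ?_, rfl⟩
        have : (⟨ε • g, smul_mem_traceSubmodule _ _⟩ : traceSubmodule ε G) =
            ε • ⟨ε • g, smul_mem_traceSubmodule _ _⟩ :=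
          Subtype.ext (by simp [smul_smul, hε.eq])
        rw [this]
        change s (ε • _) ∈ traceSubmodule ε N
        rw [map_smul]
        exact smul_mem_traceSubmodule _ _
      obtain ⟨k', hk', h⟩ := hle k.2
      obtain rfl : k' = k := Subtype.ext h
      exact hk'
    let π : traceSubmodule ε N →ₗ[A] traceSubmodule ε G :=
      p.restrict (fun _ hk => map_mem_traceSubmodule p hk)
    -- For a generator `k = ε • m`, the difference `k - s (π k)` comes from some `m'` in `N'` and is
    -- fixed by `ε`; hence it also comes from `ε • m'`, which lies in the trace.
    have hdec (k : traceSubmodule ε N) :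
        ∃ k' : traceSubmodule ε N', i k' = k - s (π k) := by
      have hle : traceSubmodule ε N ≤
          (((traceSubmodule ε N').map i).comap
            (Submodule.subtype _ - s ∘ₗ π)).map (Submodule.subtype _) := by
        refine traceSubmodule_le_iff.2 fun m => ?_
        refine ⟨⟨ε • m, smul_mem_traceSubmodule _ _⟩, ?_, rfl⟩
        set k : traceSubmodule ε N := ⟨ε • m, smul_mem_traceSubmodule _ _⟩ with hk
        have hεk : ε • k = k := Subtype.ext (by simp [hk, smul_smul, hε.eq])
        have hu : p ((k : N) - s (π k)) = 0 := by
          rw [map_sub, hs]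
          exact sub_self _
        obtain ⟨m', hm'⟩ := (hip _).1 hu
        refine ⟨ε • m', smul_mem_traceSubmodule _ _, ?_⟩
        rw [map_smul, hm', smul_sub, ← map_smul, ← map_smul, hεk]
        exact congrArg (· - s (π k)) (congrArg Subtype.val hεk)
      obtain ⟨k₁, ⟨k', hk', h'⟩, h⟩ := hle k.2
      obtain rfl : k₁ = k := Subtype.ext h
      exact ⟨⟨k', hk'⟩, h'⟩
    let j' : traceSubmodule ε N' →ₗ[A] N := i ∘ₗ Submodule.subtype _
    have hj' : Function.Injective j' := hi.comp Subtype.val_injective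
    let a : traceSubmodule ε N →ₗ[A] traceSubmodule ε N' :=
      (LinearEquiv.ofInjective j' hj').symm.toLinearMap ∘ₗ
        (Submodule.subtype (traceSubmodule ε N) - s ∘ₗ π).codRestrict (LinearMap.range j') hdec
    have ha (k) : i (a k) = k - s (π k) :=
      congrArg Subtype.val ((LinearEquiv.ofInjective j' hj').apply_symm_apply
        ((Submodule.subtype (traceSubmodule ε N) - s ∘ₗ π).codRestrict (LinearMap.range j')
          hdec k))
    constructor
    · refine hK'.of_add hK a π (i.restrict fun _ hk => map_mem_traceSubmodule i hk)
        (s.codRestrict _ hsmem) fun k => Subtype.ext ?_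
      change i (a k) + s (π k) = k
      rw [ha, sub_add_cancel]
    · refine ⟨_, ModuleCat.of A (G ⧸ traceSubmodule ε G),
        Submodule.mapQ _ (traceSubmodule ε N) i fun _ hk => map_mem_traceSubmodule i hk,
        Submodule.mapQ _ (traceSubmodule ε G) p fun _ hk => map_mem_traceSubmodule p hk, ?_, ?_, ?_, hN',
        h2.quotient_trace hx hS⟩
      · rw [injective_iff_map_eq_zero]
        intro q hq
        obtain ⟨y, rfl⟩ := Submodule.mkQ_surjective _ q
        have hy : i y ∈ traceSubmodule ε N := (Submodule.Quotient.mk_eq_zero _).1 hq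
        refine (Submodule.Quotient.mk_eq_zero _).2 ?_
        obtain ⟨k', hk'⟩ := hdec ⟨i y, hy⟩
        have hπ : π ⟨i y, hy⟩ = 0 := Subtype.ext (hip.apply_apply_eq_zero y)
        rw [hπ, map_zero, sub_zero] at hk'
        rw [← hi hk']
        exact k'.2
      · intro q
        obtain ⟨g, rfl⟩ := Submodule.mkQ_surjective _ q
        obtain ⟨m, rfl⟩ := hp g
        exact ⟨Submodule.Quotient.mk m, rfl⟩
      · intro q
        obtain ⟨m, rfl⟩ := Submodule.mkQ_surjective _ q
        constructor
        · intro hq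
          have hm : p m ∈ traceSubmodule ε G := (Submodule.Quotient.mk_eq_zero _).1 hq
          obtain ⟨m', hm'⟩ := (hip (m - s ⟨p m, hm⟩)).1 (by
            rw [map_sub, hs]
            exact sub_self _)
          refine ⟨Submodule.Quotient.mk m', ?_⟩
          refine (Submodule.Quotient.eq _).2 ?_
          rw [hm', sub_sub_cancel_left]
          exact neg_mem (hsmem _)
        · rintro ⟨q', hq'⟩
          obtain ⟨y, rfl⟩ := Submodule.mkQ_surjective _ q'
          rw [← hq']
          change Submodule.Quotient.mk (p (i y)) = 0
          rw [hip.apply_apply_eq_zero]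
          rfl

end

end

end Trace

/-! ### Acyclicity of the defining ideals of the quotient rings -/

section OuterIdeal

variable {A : Type u} [Ring A] {X : Type v} (e : X → A)

lemma mem_outerIdeal_of_notMem {Y : Set X} {x : X} (hx : x ∉ Y) (a b : A) :
    a * e x * b ∈ outerIdeal e Y :=
  Ideal.subset_span ⟨x, hx, a, b, rfl⟩

lemma outerIdeal_le_iff {Y : Set X} {P : Submodule A A} :
    outerIdeal e Y ≤ P ↔ ∀ x ∉ Y, ∀ a b : A, a * e x * b ∈ P := by
  rw [outerIdeal, Ideal.span, Submodule.span_le]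
  exact ⟨fun h x hx a b => h ⟨x, hx, a, b, rfl⟩, by rintro h _ ⟨x, hx, a, b, rfl⟩; exact h x hx a b⟩

lemma outerIdeal_anti {Y Y' : Set X} (h : Y ⊆ Y') : outerIdeal e Y' ≤ outerIdeal e Y :=
  (outerIdeal_le_iff e).2 fun _ hx a b => mem_outerIdeal_of_notMem e (fun hY => hx (h hY)) a b

lemma outerIdeal_univ : outerIdeal e Set.univ = ⊥ :=
  le_bot_iff.1 ((outerIdeal_le_iff e).2 fun _ hx _ _ => (hx (Set.mem_univ _)).elim)

/-- A map from `A_Y e_x` lifts along surjections from modules killed by the ideal of `Y`. -/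
lemma liftsAlong_quotientModule {x : X} (hx : IsIdempotentElem (e x)) (Y : Set X) :
    LiftsAlong (A := A) (quotientModule e Y x)
      (fun N => ∀ r ∈ outerIdeal e Y, ∀ m : N, r • m = 0) := by
  intro N G hN p hp f
  let t : quotientModule e Y x := ⟨Ideal.Quotient.mk _ (e x), Submodule.mem_span_singleton_self _⟩
  obtain ⟨n, hn⟩ := hp (f t)
  let g₀ : QuotientRing e Y →ₗ[A] N :=
    Submodule.liftQ (outerIdeal e Y) (LinearMap.toSpanSingleton A N n) (fun r hr => hN r hr n)
  refine ⟨g₀ ∘ₗ Submodule.subtype _, ?_⟩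
  rintro ⟨q, hq⟩
  obtain ⟨a, rfl⟩ := Submodule.mem_span_singleton.1 hq
  have h1 : (⟨a • Ideal.Quotient.mk (outerIdeal e Y) (e x), hq⟩ : quotientModule e Y x) = a • t :=
    rfl
  have h2 : e x • t = t := Subtype.ext (congrArg (Ideal.Quotient.mk (outerIdeal e Y)) hx.eq)
  change p ((a * e x) • n) = _
  rw [map_smul, hn, h1, map_smul, mul_smul, ← map_smul, h2]

/-- `A_Y e_x` is `A e_x` modulo its intersection with the ideal. Right multiplication by `e x`
retracts the ideal onto that intersection, so the quotient case applies. -/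
lemma homAcyclic_quotientModule {J : CochainComplex (ModuleCat.{u} A) ℤ}
    [∀ n, Injective (J.X n)] {Y : Set X} {x : X} (hx : IsIdempotentElem (e x))
    (hJ : HomAcyclic J (Submodule.span A {e x})) (hY : HomAcyclic J (outerIdeal e Y)) :
    HomAcyclic J (quotientModule e Y x) := by
  have hmul (a : A) (ha : a ∈ Submodule.span A {e x}) : a * e x = a := by
    obtain ⟨b, rfl⟩ := Submodule.mem_span_singleton.1 ha
    rw [smul_eq_mul, mul_assoc, hx.eq]
  let N' : Submodule A A := outerIdeal e Y ⊓ Submodule.span A {e x}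
  have hN' : HomAcyclic J N' := by
    refine hY.of_retract (Submodule.inclusion inf_le_left)
      ((LinearMap.toSpanSingleton A A (e x)).restrict (p := outerIdeal e Y) (q := N')
        fun a ha => ⟨Ideal.mul_mem_right _ _ ha, Submodule.mem_span_singleton.2 ⟨a, rfl⟩⟩) ?_
    rintro ⟨a, ha⟩
    exact Subtype.ext (hmul a ha.2)
  let g₀ : A →ₗ[A] QuotientRing e Y := Submodule.mkQ (outerIdeal e Y)
  have hg₀ : ∀ a ∈ Submodule.span A {e x}, g₀ a ∈ quotientModule e Y x := by
    intro a ha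
    obtain ⟨b, rfl⟩ := Submodule.mem_span_singleton.1 ha
    exact Submodule.mem_span_singleton.2 ⟨b, rfl⟩
  refine hN'.of_quotient hJ (Submodule.inclusion inf_le_right) (g₀.restrict hg₀)
    (Submodule.inclusion_injective _) ?_ ?_
  · rintro ⟨q, hq⟩
    obtain ⟨a, rfl⟩ := Submodule.mem_span_singleton.1 hq
    exact ⟨⟨a • e x, Submodule.mem_span_singleton.2 ⟨a, rfl⟩⟩, rfl⟩
  · rintro ⟨a, ha⟩
    have : (g₀.restrict hg₀) ⟨a, ha⟩ = 0 ↔ a ∈ outerIdeal e Y :=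
      Subtype.ext_iff.trans (Submodule.Quotient.mk_eq_zero _)
    rw [this]
    constructor
    · intro h
      exact ⟨⟨a, h, ha⟩, rfl⟩
    · rintro ⟨y, hy⟩
      have : (y : A) = a := congrArg Subtype.val hy
      exact this ▸ y.2.1

variable [PartialOrder X]

lemma traceSubmodule_standardModule {x : X} (hx : IsIdempotentElem (e x)) :
    traceSubmodule (e x) (standardModule e x) = ⊤ := by
  rw [eq_top_iff]
  rintro ⟨q, hq⟩ -
  obtain ⟨a, rfl⟩ := Submodule.mem_span_singleton.1 hq
  let t : standardModule e x :=
    ⟨Ideal.Quotient.mk _ (e x), Submodule.mem_span_singleton_self _⟩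
  have h2 : e x • t = t := Subtype.ext (congrArg (Ideal.Quotient.mk (outerIdeal e _)) hx.eq)
  change a • t ∈ _
  rw [← h2]
  exact Submodule.smul_mem _ _ (smul_mem_traceSubmodule _ _)

lemma smul_standardModule_eq_zero {x z : X} (hxz : ¬ x ≤ z) (v : standardModule e z) :
    e x • v = 0 := by
  obtain ⟨q, hq⟩ := v
  obtain ⟨a, rfl⟩ := Submodule.mem_span_singleton.1 hq
  refine Subtype.ext ?_
  refine (Submodule.Quotient.mk_eq_zero (outerIdeal e (Set.Iic z)) (x := e x * (a * e z))).2 ?_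
  have := mem_outerIdeal_of_notMem e (Y := Set.Iic z) hxz 1 (a * e z)
  rwa [one_mul] at this

variable {e}

/-- The data of filtrations of the modules `A_Y e_y` by standard modules. -/
def HasStandardFiltrations (e : X → A) (Y : Set X) : Prop :=
  ∀ y, ∃ (n : ℕ) (N : ModuleCat.{u} A) (p : A →ₗ[A] N), Function.Surjective p ∧
    (∀ a, p a = 0 ↔ a * e y ∈ outerIdeal e Y) ∧
    IsFiltered (fun z : X => standardModule e z) Y n N

lemma hasStandardFiltrations_univ
    (hF : ∀ x : X, HasFiltrationBy (A := A) (fun y : X => standardModule e y)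
      (Submodule.span A {e x})) : HasStandardFiltrations e Set.univ := by
  intro y
  obtain ⟨n, hn⟩ := (hF y).isFiltered
  refine ⟨n, _, (LinearMap.toSpanSingleton A A (e y)).codRestrict (Submodule.span A {e y})
    (fun a => Submodule.mem_span_singleton.2 ⟨a, rfl⟩), ?_, ?_, hn⟩
  · rintro ⟨q, hq⟩
    obtain ⟨a, rfl⟩ := Submodule.mem_span_singleton.1 hq
    exact ⟨a, rfl⟩
  · intro a
    rw [outerIdeal_univ]
    exact Subtype.ext_iff

/-! ### Descending induction over initial segments -/

variable [Fintype X]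

/-- The maps `p y` together present `outerIdeal e Y` as an extension of the product over `y` of the
traces of `e x` in `N y` by `outerIdeal e (insert x Y)`. The filtrations must be carried along,
since they control the traces at the next stage. -/
theorem HasStandardFiltrations.step (he : CompleteOrthogonalIdempotents e)
    (hM : StandardModulesIndependent e) {Y : Set X} {x : X} (hY : IsLowerSet Y) (hx : x ∉ Y)
    (hY' : IsLowerSet (insert x Y)) (h : HasStandardFiltrations e (insert x Y))
    {J : CochainComplex (ModuleCat.{u} A) ℤ} [∀ n, Injective (J.X n)]
    (hJ : HomAcyclic J (Submodule.span A {e x}))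
    (hJY : HomAcyclic J (outerIdeal e (insert x Y))) :
    HasStandardFiltrations e Y ∧ HomAcyclic J (outerIdeal e Y) := by
  have hidem := he.toOrthogonalIdempotents.idem x
  have hmax : Maximal (· ∈ insert x Y) x := by
    refine ⟨Set.mem_insert _ _, ?_⟩
    rintro z (rfl | hz) hxz
    · exact le_rfl
    · exact (hx (hY hxz hz)).elim
  have hmaxI : Maximal (· ∈ Set.Iic x) x := ⟨le_rfl, fun z hz _ => hz⟩
  -- Independence of the initial segment is needed here: the standard module at `x` becomes `A_Z
  -- e_x` for `Z = insert x Y`, which is projective over `A_Z` and a quotient of `A e_x` by a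
  -- summand of the current ideal.
  obtain ⟨φ⟩ := hM (Set.Iic x) (insert x Y) x (isLowerSet_Iic x) hY' hmaxI hmax
  have hle : outerIdeal e (insert x Y) ≤ outerIdeal e Y := outerIdeal_anti e (Set.subset_insert _ _)
  choose n N p hp hker hfilt using h
  have hkill (y : X) : ∀ r ∈ outerIdeal e (insert x Y), ∀ m : N y, r • m = 0 := by
    intro r hr m
    obtain ⟨b, rfl⟩ := hp y m
    rw [← map_smul, hker, smul_eq_mul]
    exact Ideal.mul_mem_right _ _ (Ideal.mul_mem_right _ _ hr)
  have hlift : LiftsAlong (A := A) (standardModule e x)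
      (fun N => ∀ r ∈ outerIdeal e (insert x Y), ∀ m : N, r • m = 0) := by
    intro N G hN q hq f
    obtain ⟨g, hg⟩ := liftsAlong_quotientModule e hidem (insert x Y) N G hN q hq
      (f ∘ₗ φ.symm.toLinearMap)
    exact ⟨g ∘ₗ φ.toLinearMap, fun t => by simp [hg]⟩
  have htrace (y : X) := IsFiltered.trace (V := fun z : X => standardModule e z) (S := Y)
    (traceSubmodule_standardModule e hidem)
    (fun z hz v => smul_standardModule_eq_zero e (fun hxz => hx (hY hxz hz)) v) hidem hlift
    (fun N' N i hi hN r hr m => hi (by rw [map_smul, map_zero, hN r hr]))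
    (n y) (N y) (hkill y) (hfilt y)
  have hmem (y : X) {r : A} (hr : r ∈ outerIdeal e Y) :
      p y r ∈ traceSubmodule (e x) (N y) := by
    have : outerIdeal e Y ≤ (traceSubmodule (e x) (N y)).comap (p y) := by
      refine (outerIdeal_le_iff e).2 fun z hz a b => ?_
      rw [Submodule.mem_comap]
      by_cases hzx : z = x
      · subst hzx
        have : p y (a * e z * b) = a • e z • p y b := by
          rw [← map_smul, ← map_smul, smul_eq_mul, smul_eq_mul, mul_assoc]
        rw [this]
        exact Submodule.smul_mem _ _ (smul_mem_traceSubmodule _ _)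
      · have : p y (a * e z * b) = 0 := by
          rw [hker, mul_assoc]
          exact mem_outerIdeal_of_notMem e (by simp [hzx, hz]) _ _
        rw [this]
        exact Submodule.zero_mem _
    exact this hr
  have hmul (y : X) (a : A) : p y (a * e y) = p y a := by
    rw [← sub_eq_zero, ← map_sub, hker, sub_mul, mul_assoc,
      (he.toOrthogonalIdempotents.idem y).eq, sub_self]
    exact Submodule.zero_mem _
  -- The trace is thus the image of `outerIdeal e Y`, so `N y` modulo the trace presents `A_Y e_y`.
  have hiff (y : X) (a : A) : p y a ∈ traceSubmodule (e x) (N y) ↔ a * e y ∈ outerIdeal e Y := by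
    constructor
    · intro ha
      have : traceSubmodule (e x) (N y) ≤ Submodule.map (p y) (outerIdeal e Y) := by
        refine traceSubmodule_le_iff.2 fun m => ?_
        obtain ⟨b, rfl⟩ := hp y m
        refine ⟨e x * b, ?_, ?_⟩
        · have := mem_outerIdeal_of_notMem e hx 1 b
          rwa [one_mul] at this
        · rw [← smul_eq_mul, map_smul]
      obtain ⟨r, hr, hra⟩ := this ha
      have h1 : (a - r) * e y ∈ outerIdeal e (insert x Y) := by
        rw [← hker, map_sub, hra, sub_self]
      have h2 := add_mem (hle h1) (Ideal.mul_mem_right (e y) _ hr)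
      rwa [← add_mul, sub_add_cancel] at h2
    · intro ha
      rw [← hmul]
      exact hmem y ha
  constructor
  · intro y
    refine ⟨n y, _, Submodule.mkQ _ ∘ₗ p y, (Submodule.mkQ_surjective _).comp (hp y), fun a => ?_,
      (htrace y).2⟩
    rw [← hiff]
    exact Submodule.Quotient.mk_eq_zero _
  · have hstd : HomAcyclic J (standardModule e x) :=
      (homAcyclic_quotientModule e hidem hJ hJY).of_retract φ.toLinearMap φ.symm.toLinearMap
        (by simp)
    have htr (y : X) : HomAcyclic J (traceSubmodule (e x) (N y)) := by
      obtain ⟨ι, _, γ, i, r, hγ, hri⟩ := (htrace y).1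
      obtain rfl : γ = fun _ => x := funext hγ
      exact (HomAcyclic.pi fun _ => hstd).of_retract i r hri
    let g : outerIdeal e Y →ₗ[A] ∀ y, traceSubmodule (e x) (N y) :=
      LinearMap.pi fun y => (p y).restrict fun r hr => hmem y hr
    have hg (r : outerIdeal e Y) : g r = 0 ↔ (r : A) ∈ outerIdeal e (insert x Y) := by
      have h1 : g r = 0 ↔ ∀ y, p y r = 0 :=
        funext_iff.trans (forall_congr' fun y => Subtype.ext_iff)
      rw [h1]
      constructor
      · intro h
        rw [← mul_one (r : A), ← he.complete, Finset.mul_sum]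
        exact Submodule.sum_mem _ fun y _ => (hker y _).1 (h y)
      · intro h y
        exact (hker y _).2 (Ideal.mul_mem_right _ _ h)
    refine hJY.of_extension (HomAcyclic.pi htr) (Submodule.inclusion hle) g
      (Submodule.inclusion_injective _) ?_ ?_
    · intro t
      choose s hs using fun y => hp y (t y : N y)
      have hsI (y : X) : s y * e y ∈ outerIdeal e Y := (hiff y _).1 (by rw [hs]; exact (t y).2)
      -- Orthogonality lets the components be prescribed independently: right multiplication by `e
      -- y`, invisible to `p y`, leaves only the term `s y * e y`.
      refine ⟨⟨∑ z, s z * e z, Submodule.sum_mem _ fun z _ => hsI z⟩, funext fun y => Subtype.ext ?_⟩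
      change p y (∑ z, s z * e z) = _
      rw [← hs, ← hmul y (∑ z, s z * e z), ← hmul y (s y), Finset.sum_mul,
        Finset.sum_eq_single y]
      · rw [mul_assoc, (he.toOrthogonalIdempotents.idem y).eq]
      · intro z _ hz
        rw [mul_assoc, he.toOrthogonalIdempotents.ortho hz, mul_zero]
      · simp
    · intro r
      rw [hg]
      exact ⟨fun h => ⟨⟨r, h⟩, rfl⟩, by rintro ⟨y, rfl⟩; exact y.2⟩

theorem homAcyclic_outerIdeal (he : CompleteOrthogonalIdempotents e)
    (hM : StandardModulesIndependent e)
    (hF : ∀ x : X, HasFiltrationBy (A := A) (fun y : X => standardModule e y)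
      (Submodule.span A {e x}))
    {Y : Set X} (hY : IsLowerSet Y) {J : CochainComplex (ModuleCat.{u} A) ℤ}
    [∀ n, Injective (J.X n)]
    (hJ : ∀ x ∉ Y, HomAcyclic J (Submodule.span A {e x})) :
    HomAcyclic J (outerIdeal e Y) := by
  have key (Z : Set X) : Y ⊆ Z → IsLowerSet Z →
      HasStandardFiltrations e Z ∧ HomAcyclic J (outerIdeal e Z) := by
    induction Z using WellFoundedGT.induction with
    | ind Z ih =>
    intro hYZ hZ
    by_cases hu : Z = Set.univ
    · subst hu
      refine ⟨hasStandardFiltrations_univ hF, fun i j k _ _ f _ => ⟨0, fun r => ?_⟩⟩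
      have : r = 0 := Subtype.ext (by simpa [outerIdeal_univ] using r.2)
      rw [this, map_zero, map_zero, map_zero]
    -- Minimality of `x` outside `Z` makes `insert x Z` an initial segment.
    · obtain ⟨x, hx⟩ := (Set.toFinite Zᶜ).exists_minimal (Set.nonempty_compl.2 hu)
      have hxZ : x ∉ Z := hx.1
      have hZ' : IsLowerSet (insert x Z) := by
        rintro a b hba (rfl | ha)
        · by_cases hb : b ∈ Z
          · exact Or.inr hb
          · exact Or.inl (le_antisymm hba (hx.2 hb hba))
        · exact Or.inr (hZ hba ha)
      obtain ⟨h1, h2⟩ := ih (insert x Z) (Set.ssubset_insert hxZ)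
        (hYZ.trans (Set.subset_insert _ _)) hZ'
      exact h1.step he hM hZ hxZ hZ' (hJ x fun h => hxZ (hYZ h)) h2
  exact (key Y subset_rfl hY).2

end OuterIdeal

/-! ### Comparison of derived `Hom` complexes along an exact left adjoint -/

open CochainComplex.HomComplex

section Extension

variable {C : Type u₁} [Category.{v₁} C] [Abelian C]

/-- Homotopy classes of maps into a K-injective complex are morphisms in the derived category, where
`s` is invertible. -/
theorem CochainComplex.IsKInjective.exists_extension {K L J : CochainComplex C ℤ} [J.IsKInjective]
    (s : K ⟶ L) [QuasiIso s] (t : K ⟶ J) : ∃ g : L ⟶ J, Nonempty (Homotopy (s ≫ g) t) := by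
  let := HasDerivedCategory.standard C
  obtain ⟨g, hg⟩ := (IsKInjective.Qh_map_bijective
    ((HomotopyCategory.quotient C (.up ℤ)).obj L) J).surjective
    ((DerivedCategory.quotientCompQhIso C).hom.app L ≫ inv (DerivedCategory.Q.map s) ≫
      DerivedCategory.Q.map t ≫ (DerivedCategory.quotientCompQhIso C).inv.app J)
  obtain ⟨g, rfl⟩ := (HomotopyCategory.quotient C (.up ℤ)).map_surjective g
  refine ⟨g, ⟨HomotopyCategory.homotopyOfEq _ _
    ((IsKInjective.Qh_map_bijective _ _).injective ?_)⟩⟩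
  rw [Functor.map_comp, Functor.map_comp, hg]
  simp only [DerivedCategory.quotientCompQhIso_hom_naturality_assoc, IsIso.hom_inv_id_assoc]
  rw [DerivedCategory.quotientCompQhIso_inv_naturality, Iso.hom_inv_id_app_assoc]

lemma quasiIso_of_homotopy {K L : CochainComplex C ℤ} {f g : K ⟶ L} (h : Homotopy f g)
    [QuasiIso f] : QuasiIso g := by
  rw [quasiIso_iff]
  intro n
  rw [quasiIsoAt_iff_isIso_homologyMap, ← h.homologyMap_eq n]
  infer_instance

end Extension

namespace CategoryTheory.Adjunction

variable {C : Type u₁} [Category.{v₁} C] [Abelian C] {D : Type u₂} [Category.{v₁} D] [Abelian D]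
  {F : C ⥤ D} {G : D ⥤ C} [F.Additive] [G.Additive] (adj : F ⊣ G)

/-- The unit of the adjunction on complexes. -/
def complexUnit (K : CochainComplex C ℤ) :
    K ⟶ (G.mapHomologicalComplex (.up ℤ)).obj ((F.mapHomologicalComplex (.up ℤ)).obj K) where
  f n := adj.unit.app (K.X n)
  comm' i j _ := (adj.unit.naturality (K.d i j)).symm

/-- The counit of the adjunction on complexes. -/
def complexCounit (K : CochainComplex D ℤ) :
    (F.mapHomologicalComplex (.up ℤ)).obj ((G.mapHomologicalComplex (.up ℤ)).obj K) ⟶ K where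
  f n := adj.counit.app (K.X n)
  comm' i j _ := (adj.counit.naturality (K.d i j)).symm

lemma map_complexUnit_complexCounit (K : CochainComplex C ℤ) :
    (F.mapHomologicalComplex (.up ℤ)).map (adj.complexUnit K) ≫ adj.complexCounit _ = 𝟙 _ := by
  ext n
  exact adj.left_triangle_components (K.X n)

lemma complexUnit_map_complexCounit (K : CochainComplex D ℤ) :
    adj.complexUnit _ ≫ (G.mapHomologicalComplex (.up ℤ)).map (adj.complexCounit K) = 𝟙 _ := by
  ext n
  exact adj.right_triangle_components (K.X n)

lemma complexUnit_naturality {K L : CochainComplex C ℤ} (f : K ⟶ L) :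
    f ≫ adj.complexUnit L = adj.complexUnit K ≫
      (G.mapHomologicalComplex (.up ℤ)).map ((F.mapHomologicalComplex (.up ℤ)).map f) := by
  ext n
  exact adj.unit.naturality (f.f n)

lemma complexCounit_naturality {K L : CochainComplex D ℤ} (f : K ⟶ L) :
    (F.mapHomologicalComplex (.up ℤ)).map ((G.mapHomologicalComplex (.up ℤ)).map f) ≫
      adj.complexCounit L = adj.complexCounit K ≫ f := by
  ext n
  exact adj.counit.naturality (f.f n)

include adj in
-- A map from an acyclic `K` to `G J` transposes to a map `F K ⟶ J`, whose source is acyclic because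
-- `F` is exact; its null-homotopy transposes back.
theorem isKInjective_map [F.PreservesHomology] (J : CochainComplex D ℤ) [J.IsKInjective] :
    CochainComplex.IsKInjective ((G.mapHomologicalComplex (.up ℤ)).obj J) where
  nonempty_homotopy_zero {K} f hK := by
    have hFK : ((F.mapHomologicalComplex (.up ℤ)).obj K).Acyclic := by
      exact fun n => (hK n).map F
    obtain ⟨h⟩ := CochainComplex.IsKInjective.nonempty_homotopy_zero
      ((F.mapHomologicalComplex (.up ℤ)).map f ≫ adj.complexCounit J) hFK
    refine ⟨(Homotopy.ofEq ?_).trans (((G.mapHomotopy h).compLeft (adj.complexUnit K)).trans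
      (Homotopy.ofEq (by simp)))⟩
    rw [Functor.map_comp, ← Category.assoc, ← complexUnit_naturality, Category.assoc,
      complexUnit_map_complexCounit, Category.comp_id]

/-- The transpose of a cochain. -/
noncomputable def transpose {V : CochainComplex C ℤ} {J : CochainComplex D ℤ} {n : ℤ}
    (y : Cochain ((F.mapHomologicalComplex (.up ℤ)).obj V) J n) :
    Cochain V ((G.mapHomologicalComplex (.up ℤ)).obj J) n :=
  (Cochain.ofHom (adj.complexUnit V)).comp (y.map G) (zero_add n)

lemma transpose_δ {V : CochainComplex C ℤ} {J : CochainComplex D ℤ} {n m : ℤ}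
    (y : Cochain ((F.mapHomologicalComplex (.up ℤ)).obj V) J n) :
    δ n m (adj.transpose y) = adj.transpose (δ n m y) := by
  rw [transpose, transpose, δ_ofHom_comp, δ_map]

lemma transpose_map_comp {V I : CochainComplex C ℤ} {J : CochainComplex D ℤ} {n : ℤ}
    (x : Cochain V I n) (g : (F.mapHomologicalComplex (.up ℤ)).obj I ⟶ J) :
    adj.transpose ((x.map F).comp (Cochain.ofHom g) (add_zero n)) =
      x.comp (Cochain.ofHom (adj.complexUnit I ≫ (G.mapHomologicalComplex (.up ℤ)).map g))
        (add_zero n) := by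
  ext p q hpq
  have h := adj.unit.naturality_assoc (x.v p q hpq) (G.map (g.f q))
  simp only [Functor.comp_map, Functor.id_map] at h
  simp only [transpose, complexUnit, Cochain.map_comp, Cochain.map_ofHom,
    Cochain.comp_zero_cochain_v, Cochain.zero_cochain_comp_v, Cochain.ofHom_v, Cochain.map_v,
    Functor.mapHomologicalComplex_map_f, HomologicalComplex.comp_f]
  exact h.symm

lemma map_transpose_comp {V : CochainComplex C ℤ} {J : CochainComplex D ℤ} {n : ℤ}
    (y : Cochain ((F.mapHomologicalComplex (.up ℤ)).obj V) J n) :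
    ((adj.transpose y).map F).comp (Cochain.ofHom (adj.complexCounit J)) (add_zero n) = y := by
  ext p q hpq
  have h₁ := adj.counit.naturality (y.v p q hpq)
  have h₂ := adj.left_triangle_components_assoc (V.X p) (y.v p q hpq)
  simp only [Functor.comp_map, Functor.id_map] at h₁
  simp only [transpose, complexUnit, complexCounit, Cochain.map_comp, Cochain.map_ofHom,
    Cochain.comp_zero_cochain_v, Cochain.zero_cochain_comp_v, Cochain.ofHom_v, Cochain.map_v,
    Functor.mapHomologicalComplex_map_f]
  exact (Category.assoc _ _ _).trans <| (congrArg (F.map (adj.unit.app (V.X p)) ≫ ·) h₁).trans h₂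

lemma transpose_injective {V : CochainComplex C ℤ} {J : CochainComplex D ℤ} {n : ℤ} :
    Function.Injective (adj.transpose (V := V) (J := J) (n := n)) :=
  fun y y' h => by rw [← adj.map_transpose_comp y, h, map_transpose_comp]

/-- Transposition identifies `Hom(F V, J)` with `Hom(V, G J)` and turns the map into composition
with the transpose of `g`. The cochains `a` and `b` below are the homotopies of that equivalence,
and composing a cocycle with them supplies the required coboundaries. -/
theorem quasiIso_homComplexMap (V I : CochainComplex C ℤ) (J : CochainComplex D ℤ)
    (g : (F.mapHomologicalComplex (.up ℤ)).obj I ⟶ J)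
    (hg : HomologicalComplex.homotopyEquivalences C (.up ℤ)
      (adj.complexUnit I ≫ (G.mapHomologicalComplex (.up ℤ)).map g)) :
    QuasiIso (homComplexMap F V g) := by
  obtain ⟨e, he⟩ := hg
  have h₁ := Cochain.equivHomotopy _ _ e.homotopyHomInvId
  have h₂ := Cochain.equivHomotopy _ _ e.homotopyInvHomId
  obtain ⟨a, ha⟩ := h₁
  obtain ⟨b, hb⟩ := h₂
  rw [AddCommGrpCat.quasiIso_iff_elements]
  intro i j k hij hjk
  constructor
  · intro (x : Cochain V I j) (y : Cochain _ J i) (hx : δ j k x = 0)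
      (hxy : (x.map F).comp (Cochain.ofHom g) (add_zero j) = δ i j y)
    have h := congrArg adj.transpose hxy
    rw [transpose_map_comp, ← transpose_δ, ← he] at h
    have h₁ := congrArg (fun z => Cochain.comp z (Cochain.ofHom e.inv) (add_zero j)) h
    rw [← δ_comp_ofHom, Cochain.comp_assoc_of_second_is_zero_cochain, ← Cochain.ofHom_comp, ha,
      Cochain.comp_add, Cochain.comp_id] at h₁
    have h₂ := δ_comp x a (show j + -1 = i by omega) k 0 j hij hjk (by norm_num)
    rw [hx, Cochain.zero_comp, smul_zero, add_zero] at h₂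
    refine ⟨(adj.transpose y).comp (Cochain.ofHom e.inv) (add_zero i) -
      x.comp a (show j + -1 = i by omega), ?_⟩
    have key : δ i j ((adj.transpose y).comp (Cochain.ofHom e.inv) (add_zero i) -
        x.comp a (show j + -1 = i by omega)) = x := by
      rw [δ_sub, h₂, ← h₁, add_sub_cancel_left]
    exact key
  · intro (y : Cochain _ J j) (hy : δ j k y = 0)
    have hy' : δ j k (adj.transpose y) = 0 := by
      rw [transpose_δ, hy, transpose, Cochain.map_zero, Cochain.comp_zero]
    have h₂ := δ_comp (adj.transpose y) b (show j + -1 = i by omega) k 0 j hij hjk (by norm_num)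
    rw [hy', Cochain.zero_comp, smul_zero, add_zero] at h₂
    let x : Cochain V I j := (adj.transpose y).comp (Cochain.ofHom e.inv) (add_zero j)
    let z : Cochain V _ i := (adj.transpose y).comp b (show j + -1 = i by omega)
    have hadd (y₁ y₂ : Cochain ((F.mapHomologicalComplex (.up ℤ)).obj V) J j) :
        adj.transpose (y₁ - y₂) = adj.transpose y₁ - adj.transpose y₂ := by
      rw [transpose, Cochain.map_sub, Cochain.comp_sub]
      rfl
    have hz : adj.transpose ((z.map F).comp (Cochain.ofHom (adj.complexCounit J)) (add_zero i))
        = z := by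
      rw [transpose_map_comp, complexUnit_map_complexCounit, Cochain.comp_id]
    have hx : δ j k x = 0 := by
      rw [δ_comp_ofHom, hy', Cochain.zero_comp]
    have key : (x.map F).comp (Cochain.ofHom g) (add_zero j) +
        δ i j (-(z.map F).comp (Cochain.ofHom (adj.complexCounit J)) (add_zero i)) = y := by
      apply adj.transpose_injective
      rw [δ_neg, ← sub_eq_add_neg, hadd, transpose_map_comp, ← he, ← transpose_δ, hz, h₂,
        Cochain.comp_assoc_of_second_is_zero_cochain, ← Cochain.ofHom_comp, hb,
        Cochain.comp_add, Cochain.comp_id, add_sub_cancel_left]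
    exact ⟨x, _, hx, key⟩

lemma map_complexUnit_comp_complexCounit {I : CochainComplex C ℤ} {J : CochainComplex D ℤ}
    (g : (F.mapHomologicalComplex (.up ℤ)).obj I ⟶ J) :
    (F.mapHomologicalComplex (.up ℤ)).map (adj.complexUnit I ≫
      (G.mapHomologicalComplex (.up ℤ)).map g) ≫ adj.complexCounit J = g := by
  rw [Functor.map_comp, Category.assoc, complexCounit_naturality, ← Category.assoc,
    map_complexUnit_complexCounit, Category.id_comp]

/-- A quasi-isomorphism of K-injective complexes is a homotopy equivalence, hence survives `G`,
which need not be exact. This permits replacing `J` by a complex with injective terms. -/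
lemma quasiIso_complexCounit_of_quasiIso [F.PreservesHomology] {J J' : CochainComplex D ℤ}
    [J.IsKInjective] [J'.IsKInjective] (j : J ⟶ J') [QuasiIso j]
    [QuasiIso (adj.complexCounit J')] : QuasiIso (adj.complexCounit J) := by
  obtain ⟨a, ha⟩ := (CochainComplex.IsKInjective.quasiIso_iff j).1 ‹_›
  have h : QuasiIso ((G.mapHomologicalComplex (.up ℤ)).map j) := by
    rw [← ha]
    exact (inferInstance : QuasiIso (G.mapHomotopyEquiv a).hom)
  have := adj.complexCounit_naturality j
  have h' : QuasiIso (adj.complexCounit J ≫ j) := by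
    rw [← this]
    infer_instance
  exact quasiIso_of_comp_right _ j

theorem quasiIso_RHomComparison [F.PreservesHomology] [F.ReflectsIsomorphisms]
    (V : CochainComplex C ℤ) {W : CochainComplex C ℤ} (I : KInjectiveResolution W)
    (J : KInjectiveResolution ((F.mapHomologicalComplex (.up ℤ)).obj W))
    [QuasiIso (adj.complexCounit J.complex)]
    (g : (F.mapHomologicalComplex (.up ℤ)).obj I.complex ⟶ J.complex)
    (hg : IsComparison F I J g) : QuasiIso (RHomComparison F V I J g) := by
  have := I.quasiIso
  have := J.quasiIso
  have := I.isKInjective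
  have := J.isKInjective
  have := adj.isKInjective_map J.complex
  obtain ⟨h⟩ := hg
  have := quasiIso_of_homotopy h.symm
  have hg : QuasiIso g := quasiIso_of_comp_left
    ((F.mapHomologicalComplex (.up ℤ)).map I.ι) g
  rw [← adj.map_complexUnit_comp_complexCounit g] at hg
  have := quasiIso_of_comp_right ((F.mapHomologicalComplex (.up ℤ)).map (adj.complexUnit I.complex ≫
    (G.mapHomologicalComplex (.up ℤ)).map g)) (adj.complexCounit J.complex)
  rw [HomologicalComplex.quasiIso_map_iff_of_preservesHomology,
    CochainComplex.IsKInjective.quasiIso_iff] at this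
  exact adj.quasiIso_homComplexMap V I.complex J.complex g this

end CategoryTheory.Adjunction

/-! ### Coextension of scalars along a quotient map -/

section Coextension

variable {A : Type u} [Ring A]

noncomputable instance (I : Ideal A) [I.IsTwoSided] :
    (ModuleCat.coextendScalars.{u, u, u} (Ideal.Quotient.mk I)).Additive :=
  (ModuleCat.restrictCoextendScalarsAdj.{u} (Ideal.Quotient.mk I)).right_adjoint_additive

instance {B : Type u} [Ring B] (f : A →+* B) :
    (ModuleCat.restrictScalars.{u} f).PreservesHomology :=
  Functor.preservesHomology_of_map_exact _ fun S hS => by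
    rw [ShortComplex.moduleCat_exact_iff] at hS ⊢
    exact hS

variable (I : Ideal A) [I.IsTwoSided]

variable {I} in
lemma smul_restrictScalars_eq_zero {N : ModuleCat.{u} (A ⧸ I)} {r : A} (hr : r ∈ I)
    (n : (ModuleCat.restrictScalars (Ideal.Quotient.mk I)).obj N) : r • n = 0 := by
  have h := congrArg (fun s : A ⧸ I => s • (show N from n)) (Ideal.Quotient.eq_zero_iff_mem.2 hr)
  exact h.trans (zero_smul _ _)

lemma coextendScalars_mk_apply (M : ModuleCat.{u} A)
    (g : (ModuleCat.coextendScalars.{u, u, u} (Ideal.Quotient.mk I)).obj M) (r : A) :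
    ModuleCat.CoextendScalars.equiv (Ideal.Quotient.mk I) M g (Ideal.Quotient.mk I r) =
      r • ModuleCat.CoextendScalars.equiv (Ideal.Quotient.mk I) M g (1 : A ⧸ I) := by
  refine Eq.trans (congrArg _ ?_) (map_smul _ r _)
  exact (mul_one (Ideal.Quotient.mk I r)).symm

lemma restrictCoextendScalarsAdj_counit_app_injective (M : ModuleCat.{u} A) :
    Function.Injective
      ((ModuleCat.restrictCoextendScalarsAdj.{u} (Ideal.Quotient.mk I)).counit.app M) := by
  intro g g' h
  refine ModuleCat.CoextendScalars.ext (LinearMap.ext fun s => ?_)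
  obtain ⟨r, rfl⟩ := Ideal.Quotient.mk_surjective s
  refine (coextendScalars_mk_apply I M g r).trans
    (Eq.trans ?_ (coextendScalars_mk_apply I M g' r).symm)
  exact congrArg (r • ·) h

lemma exists_restrictCoextendScalarsAdj_counit_app_eq (M : ModuleCat.{u} A) (m : M)
    (hm : ∀ r ∈ I, r • m = 0) :
    ∃ g, (ModuleCat.restrictCoextendScalarsAdj.{u} (Ideal.Quotient.mk I)).counit.app M g = m := by
  let φ : (A ⧸ I) →ₗ[A] M := Submodule.liftQ I (LinearMap.toSpanSingleton A M m) hm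
  let ψ : (ModuleCat.restrictScalars (Ideal.Quotient.mk I)).obj (ModuleCat.of _ (A ⧸ I)) →ₗ[A] M :=
    { toFun := φ
      map_add' := φ.map_add
      map_smul' := fun r s => by
        obtain ⟨s, rfl⟩ := Ideal.Quotient.mk_surjective s
        exact mul_smul r s m }
  exact ⟨(ModuleCat.CoextendScalars.equiv (Ideal.Quotient.mk I) M).symm ψ, one_smul A m⟩

lemma smul_restrictCoextendScalarsAdj_counit_app (M : ModuleCat.{u} A) (r : A) (hr : r ∈ I)
    (g : (ModuleCat.restrictScalars (Ideal.Quotient.mk I)).obj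
      ((ModuleCat.coextendScalars.{u, u, u} (Ideal.Quotient.mk I)).obj M)) :
    r • (ModuleCat.restrictCoextendScalarsAdj.{u} (Ideal.Quotient.mk I)).counit.app M g = 0 := by
  rw [← map_smul]
  exact (congrArg _ (smul_restrictScalars_eq_zero hr g)).trans (map_zero _)

/-- The counit, evaluation at `1`, embeds the elements killed by `I`. Its cokernel is `Hom(I, J)`
because the terms of `J` are injective, and that complex is acyclic; the proof is the corresponding
chase. -/
theorem HomAcyclic.quasiIso_complexCounit {J : CochainComplex (ModuleCat.{u} A) ℤ}
    [∀ n, Injective (J.X n)] (hJ : HomAcyclic J I) :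
    QuasiIso ((ModuleCat.restrictCoextendScalarsAdj.{u} (Ideal.Quotient.mk I)).complexCounit J) := by
  rw [ModuleCat.quasiIso_iff_elements]
  intro i j k hij hjk
  let ε := (ModuleCat.restrictCoextendScalarsAdj.{u} (Ideal.Quotient.mk I)).complexCounit J
  let K := ((ModuleCat.restrictScalars (Ideal.Quotient.mk I)).mapHomologicalComplex (.up ℤ)).obj
    (((ModuleCat.coextendScalars.{u, u, u} (Ideal.Quotient.mk I)).mapHomologicalComplex
      (.up ℤ)).obj J)
  have hinj (n : ℤ) : Function.Injective (ε.f n) :=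
    restrictCoextendScalarsAdj_counit_app_injective I (J.X n)
  have hex (n : ℤ) (m : J.X n) (hm : ∀ r ∈ I, r • m = 0) : ∃ g, ε.f n g = m :=
    exists_restrictCoextendScalarsAdj_counit_app_eq I (J.X n) m hm
  have hsmul (n : ℤ) (r : A) (hr : r ∈ I) (g : K.X n) : r • ε.f n g = 0 :=
    smul_restrictCoextendScalarsAdj_counit_app I (J.X n) r hr g
  have hcomm (a b : ℤ) (g : K.X a) : ε.f b (K.d a b g) = J.d a b (ε.f a g) :=
    (ConcreteCategory.congr_hom (ε.comm a b) g).symm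
  have hdd (a b c : ℤ) (m : J.X a) : J.d b c (J.d a b m) = 0 :=
    ConcreteCategory.congr_hom (J.d_comp_d a b c) m
  constructor
  · intro x y hx hxy
    obtain ⟨h, hh⟩ := hJ (i - 1) i j (by omega) hij
      ((LinearMap.toSpanSingleton A (J.X i) y) ∘ₗ I.subtype) (fun r => by
        simp only [LinearMap.comp_apply, Submodule.subtype_apply, LinearMap.toSpanSingleton_apply,
          map_smul]
        rw [← hxy]
        exact hsmul j r r.2 x)
    obtain ⟨l, hl⟩ := (J.X (i - 1)).exists_extend_of_injective I.subtype
      I.subtype_injective h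
    -- The map `r ↦ r • y` on `I` is the boundary of `h`, which extends to `l` on `A`. Subtracting
    -- the boundary of `l 1` leaves `d y` unchanged and yields an element killed by `I`.
    obtain ⟨x', hx'⟩ := hex i (y - J.d (i - 1) i (l 1)) (fun r hr => by
      have h₁ := hh ⟨r, hr⟩
      rw [← hl] at h₁
      simp only [LinearMap.comp_apply, Submodule.subtype_apply,
        LinearMap.toSpanSingleton_apply] at h₁
      rw [smul_sub, ← h₁, ← map_smul, ← map_smul, smul_eq_mul, mul_one, sub_self])
    refine ⟨x', hinj j ?_⟩
    rw [hcomm, hx', map_sub, hdd, sub_zero]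
    exact hxy.symm
  · intro y hy
    obtain ⟨h, hh⟩ := hJ i j k hij hjk
      ((LinearMap.toSpanSingleton A (J.X j) y) ∘ₗ I.subtype) (fun r => by
        simp only [LinearMap.comp_apply, Submodule.subtype_apply, LinearMap.toSpanSingleton_apply,
          map_smul, hy, smul_zero])
    obtain ⟨l, hl⟩ := (J.X i).exists_extend_of_injective I.subtype
      I.subtype_injective h
    obtain ⟨x, hx⟩ := hex j (y - J.d i j (l 1)) (fun r hr => by
      have h₁ := hh ⟨r, hr⟩
      rw [← hl] at h₁
      simp only [LinearMap.comp_apply, Submodule.subtype_apply,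
        LinearMap.toSpanSingleton_apply] at h₁
      rw [smul_sub, ← h₁, ← map_smul, ← map_smul, smul_eq_mul, mul_one, sub_self])
    refine ⟨x, l 1, hinj k ?_, ?_⟩
    · rw [hcomm, hx, map_sub, hdd, sub_zero, hy, map_zero]
    · exact (congrArg (· + J.d i j (l 1)) hx).trans (sub_add_cancel _ _)

end Coextension

/-! ### Cohomology coming from `A_Y`-modules, and the main theorem -/

section QuotientRing

variable {A : Type u} [Ring A] {X : Type v} {e : X → A} {Y : Set X}

/-- The cohomology of `J` is that of a complex of `A_Y`-modules, on which `e x` acts as zero for `x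
∉ Y`. -/
lemma homAcyclic_of_quasiIso_restrictScalars (he : OrthogonalIdempotents e)
    {W : CochainComplex (ModuleCat.{u} (QuotientRing e Y)) ℤ}
    {J : CochainComplex (ModuleCat.{u} A) ℤ}
    (t : ((modInclusion e Y).mapHomologicalComplex (.up ℤ)).obj W ⟶ J) [QuasiIso t]
    {x : X} (hx : x ∉ Y) : HomAcyclic J (Submodule.span A {e x}) := by
  refine homAcyclic_span_singleton (he.idem x) fun i j k hij hjk z hz => ?_
  obtain ⟨w, y', -, h⟩ := (ModuleCat.quasiIso_iff_elements t).1 ‹_› i j k hij hjk |>.2 z hz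
  have hw : e x • w = 0 := by
    have : e x ∈ outerIdeal e Y := by simpa using mem_outerIdeal_of_notMem e hx 1 1
    exact smul_restrictScalars_eq_zero this w
  refine ⟨e x • y', ?_⟩
  rw [← h, smul_add, ← map_smul, ← map_smul, hw, map_zero, zero_add]

end QuotientRing

theorem theorem9 {A : Type u} [Ring A] {X : Type v} [Fintype X] [PartialOrder X]
    (e : X → A) (he : CompleteOrthogonalIdempotents e)
    (hM : StandardModulesIndependent e)
    (hF : ∀ x : X, HasFiltrationBy (A := A) (fun y : X => standardModule e y)
      (Submodule.span A {e x}))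
    (Y : Set X) (hY : IsLowerSet Y) :
    ConditionR (modInclusion e Y) := by
  refine ⟨fun W => ?_, fun W => ?_, fun V W I J => ?_⟩
  · obtain ⟨K, ι, h₁, h₂, -⟩ := ModuleCat.exists_kInjective_resolution W
    exact ⟨⟨K, ι, h₁, h₂⟩⟩
  · obtain ⟨K, ι, h₁, h₂, -⟩ := ModuleCat.exists_kInjective_resolution W
    exact ⟨⟨K, ι, h₁, h₂⟩⟩
  · have := I.quasiIso
    have := J.quasiIso
    have := J.isKInjective
    refine ⟨CochainComplex.IsKInjective.exists_extension
      (((modInclusion e Y).mapHomologicalComplex (.up ℤ)).map I.ι) J.ι, fun g hg => ?_⟩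
    -- The given `J` is only K-injective; the acyclicity argument needs injective terms, so it is
    -- run on a termwise injective replacement `J'` and transferred back.
    obtain ⟨J', j, _, _, _⟩ := ModuleCat.exists_kInjective_resolution J.complex
    have := (homAcyclic_outerIdeal he hM hF hY (J := J') fun x hx =>
      homAcyclic_of_quasiIso_restrictScalars he.toOrthogonalIdempotents
        (J.ι ≫ j) hx).quasiIso_complexCounit
    let adj := ModuleCat.restrictCoextendScalarsAdj.{u} (Ideal.Quotient.mk (outerIdeal e Y))
    have := adj.quasiIso_complexCounit_of_quasiIso j
    exact adj.quasiIso_RHomComparison V I J g hg
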